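/- Let $\tau(z,w)=(\bar z,\bar w)$ be complex conjugation on $\mathbb C^2$. A $C^\infty$ hypersurface in $\mathbb C^2$ is an embedded real $C^\infty$ submanifold of codimension $1$ (without boundary, not necessarily closed). It is Levi-flat if its complex tangent bundle $T^cS=TS\cap J(TS)$ is involutive, where $J$ is multiplication by $i$. A set $H\subset\mathbb C^2$ is a $C^\infty$ hypersurface with boundary $\partial H\subset H$ if $H\setminus\partial H$ is a $C^\infty$ hypersurface and every $p\in\partial H$ has an open neighbourhood $W$ with a $C^\infty$ diffeomorphism $\varphi\colon W\to\mathbb R^4$ such that $\varphi(H\cap W)=\{x_3\ge 0,\ x_4=0\}$ and $\varphi(\partial H\cap W)=\{x_3=0,\ x_4=0\}$; it is called Levi-flat if $H\setminus\partial H$ is Levi-flat. **Theorem.** Let $H\subset\mathbb C^2$ be a Levi-flat $C^\infty$ hypersurface with boundary such that $0\in\partial H\subset\mathbb R^2$. Then there is an open neighbourhood $U\subset\mathbb C^2$ of $0$ with $U=\tau(U)$ such that $(H\cap U)\cup\tau(H\cap U)$ is a $C^\infty$ Levi-flat hypersurface (without boundary). -/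

import Mathlib

open scoped ContDiff Topology

/-- A `C^∞` diffeomorphism from the open set `e.source` of `ℂ²` onto the open set `e.target`
of `ℝ⁴` (smoothness is in the real sense). -/
def IsSmoothDiffeo (e : OpenPartialHomeomorph (ℂ × ℂ) (Fin 4 → ℝ)) : Prop :=
  ContDiffOn ℝ ∞ e e.source ∧ ContDiffOn ℝ ∞ e.symm e.target

/-- `S ⊆ ℂ²` is a `C^∞` (embedded real) hypersurface without boundary: near each of its points
it is straightened to `x₄ = 0` by a diffeomorphism onto an open subset of `ℝ⁴`. -/
def IsSmoothHypersurface (S : Set (ℂ × ℂ)) : Prop :=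
  ∀ p ∈ S, ∃ e : OpenPartialHomeomorph (ℂ × ℂ) (Fin 4 → ℝ),
    IsSmoothDiffeo e ∧ p ∈ e.source ∧ e '' (S ∩ e.source) = {x ∈ e.target | x 3 = 0}

/-- `H ⊆ ℂ²` is a `C^∞` hypersurface with boundary, whose boundary is `bH`. -/
structure IsSmoothHypersurfaceWithBoundary (H bH : Set (ℂ × ℂ)) : Prop where
  boundary_subset : bH ⊆ H
  interior_hypersurface : IsSmoothHypersurface (H \ bH)
  boundary_chart : ∀ p ∈ bH, ∃ e : OpenPartialHomeomorph (ℂ × ℂ) (Fin 4 → ℝ),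
    IsSmoothDiffeo e ∧ p ∈ e.source ∧ e.target = Set.univ ∧
    e '' (H ∩ e.source) = {x | 0 ≤ x 2 ∧ x 3 = 0} ∧
    e '' (bH ∩ e.source) = {x | x 2 = 0 ∧ x 3 = 0}

/-- The tangent space `T_p S` of a submanifold `S` of `ℂ²`: velocities at `p` of smooth curves
in `S`. -/
def tangentVectors (S : Set (ℂ × ℂ)) (p : ℂ × ℂ) : Set (ℂ × ℂ) :=
  {v | ∃ γ : ℝ → ℂ × ℂ, ContDiffAt ℝ ∞ γ 0 ∧ γ 0 = p ∧ (∀ᶠ t in 𝓝 (0 : ℝ), γ t ∈ S) ∧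
    deriv γ 0 = v}

/-- The complex tangent space `T^c_p S = J (T_p S) ∩ T_p S`, `J` being multiplication by `i`. -/
def complexTangentVectors (S : Set (ℂ × ℂ)) (p : ℂ × ℂ) : Set (ℂ × ℂ) :=
  (fun v => Complex.I • v) '' tangentVectors S p ∩ tangentVectors S p

/-- A smooth hypersurface `S` is Levi-flat if the bundle `T^c S` is involutive: the Lie bracket of
any two local sections is again a section. Local sections are given by smooth vector fields on open
sets of `ℂ²` whose restrictions to `S` take values in `T^c S`; on `S` their bracket depends only on
these restrictions. -/
def IsLeviFlat (S : Set (ℂ × ℂ)) : Prop :=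
  ∀ (V : Set (ℂ × ℂ)) (X Y : ℂ × ℂ → ℂ × ℂ), IsOpen V →
    ContDiffOn ℝ ∞ X V → ContDiffOn ℝ ∞ Y V →
    (∀ q ∈ S ∩ V, X q ∈ complexTangentVectors S q) →
    (∀ q ∈ S ∩ V, Y q ∈ complexTangentVectors S q) →
    ∀ q ∈ S ∩ V, VectorField.lieBracket ℝ X Y q ∈ complexTangentVectors S q

/-- Complex conjugation `τ(z, w) = (z̄, w̄)` on `ℂ²`. -/
def conjC2 (p : ℂ × ℂ) : ℂ × ℂ :=
  (starRingEnd ℂ p.1, starRingEnd ℂ p.2)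

/-- The totally real plane `ℝ² ⊆ ℂ²`. -/
def realPlane : Set (ℂ × ℂ) :=
  {p | p.1.im = 0 ∧ p.2.im = 0}

/-! The boundary is a smooth surface contained in ℝ², hence open in ℝ² near 0
(`eventually_mem_of_subset_realPlane`). A real matrix acts on ℂ² and commutes with conjugation. A
suitable one puts `H` near 0 in the form: the half y ≥ 0 of a smooth graph Im w = r(z, u), where z =
x + iy, u = Re w and r = 0 on y = 0 (`exists_graph`).

Let a = α + iβ be the slope of the complex tangent line ℂ(1, a) of the graph. Levi-flatness says
that a is holomorphic along these lines (`IsLeviFlat.leviEq`, `isLeviFlat_of_leviEq`). Together with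
∂y r = α + β ∂u r this is a first-order system that expresses the y-derivatives of r, α, β through
their values and their x- and u-derivatives. The conjugate graph, of s(z, u) = -r(z̄, u), satisfies
the same system on the side y < 0. On y = 0 the two share the Cauchy data: r and β vanish, and α is
unchanged by reflection. By induction on the order, all y-derivatives agree on y = 0
(`eqJet_reflect`); this is the formal uniqueness in Cauchy–Kovalevskaya and needs no analyticity.

Hence r for y ≥ 0 and s for y < 0 glue to a smooth function (`glue_contDiffOn`). Its graph is the
union of `H` and its conjugate, and the Levi-flatness equation extends to y = 0 by continuity
(`exists_reflection_of_graph`). -/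

/-- The derivative of a function on `ℂ × ℝ` in a fixed direction. -/
noncomputable def dirDeriv (v : ℂ × ℝ) (f : ℂ × ℝ → ℝ) : ℂ × ℝ → ℝ := fun p => fderiv ℝ f p v

local notation "∂x" => dirDeriv ((1 : ℂ), (0 : ℝ))
local notation "∂y" => dirDeriv (Complex.I, (0 : ℝ))
local notation "∂u" => dirDeriv ((0 : ℂ), (1 : ℝ))

/-! ### Directional derivatives on ℂ × ℝ. -/

section DirDeriv

variable {f g : ℂ × ℝ → ℝ} {v w : ℂ × ℝ}

theorem contDiff_dirDeriv (hf : ContDiff ℝ ∞ f) : ContDiff ℝ ∞ (dirDeriv v f) :=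
  (hf.fderiv_right (m := ∞) (by simp)).clm_apply contDiff_const

theorem dirDeriv_neg : dirDeriv v (-f) = -dirDeriv v f := by
  funext p
  simp [dirDeriv, fderiv_neg]

theorem dirDeriv_add (hf : ContDiff ℝ ∞ f) (hg : ContDiff ℝ ∞ g) :
    dirDeriv v (f + g) = dirDeriv v f + dirDeriv v g := by
  funext p
  simp [dirDeriv, fderiv_add (hf.differentiable (by simp) p) (hg.differentiable (by simp) p)]

theorem dirDeriv_mul (hf : ContDiff ℝ ∞ f) (hg : ContDiff ℝ ∞ g) :
    dirDeriv v (f * g) = dirDeriv v f * g + f * dirDeriv v g := by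
  funext p
  simp [dirDeriv, fderiv_mul (hf.differentiable (by simp) p) (hg.differentiable (by simp) p)]
  ring

theorem dirDeriv_comm (hf : ContDiff ℝ ∞ f) :
    dirDeriv v (dirDeriv w f) = dirDeriv w (dirDeriv v f) := by
  funext p
  have hd : DifferentiableAt ℝ (fderiv ℝ f) p :=
    (hf.fderiv_right (m := ∞) (by simp)).differentiable (by simp) p
  have key : ∀ a b : ℂ × ℝ, dirDeriv a (dirDeriv b f) p = fderiv ℝ (fderiv ℝ f) p a b := by
    intro a b
    have := (hd.hasFDerivAt.clm_apply (hasFDerivAt_const b p)).fderiv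
    change fderiv ℝ (fun q => fderiv ℝ f q b) p a = _
    rw [this]
    simp
  rw [key, key]
  exact (hf.contDiffAt.isSymmSndFDerivAt
    (by simpa using WithTop.coe_le_coe.2 (le_top : (2 : ℕ∞) ≤ ⊤))).eq v w

theorem dirDeriv_eq_of_eventuallyEq {p : ℂ × ℝ} (h : f =ᶠ[𝓝 p] g) :
    dirDeriv v f =ᶠ[𝓝 p] dirDeriv v g := by
  filter_upwards [h.eventuallyEq_nhds] with q hq
  simp [dirDeriv, hq.fderiv_eq]

theorem fderiv_apply_eq (f : ℂ × ℝ → ℝ) (p v : ℂ × ℝ) :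
    fderiv ℝ f p v = v.1.re * ∂x f p + v.1.im * ∂y f p + v.2 * ∂u f p := by
  have hv : v = v.1.re • ((1, 0) : ℂ × ℝ) + v.1.im • ((Complex.I, 0) : ℂ × ℝ)
      + v.2 • ((0, 1) : ℂ × ℝ) := by
    ext <;> simp
  conv_lhs => rw [hv]
  simp only [map_add, map_smul, smul_eq_mul, dirDeriv]

end DirDeriv

/-! ### Jets along the hyperplane y = 0. -/

/-- The functions `f` and `g` have, at the points of `B` with `y = 0`, the same derivatives in `y`
of every order less than `n`. -/
def EqJet (B : Set (ℂ × ℝ)) (n : ℕ) (f g : ℂ × ℝ → ℝ) : Prop :=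
  ∀ k < n, ∀ p ∈ B, p.1.im = 0 → (∂y^[k] f) p = (∂y^[k] g) p

namespace EqJet

variable {B O : Set (ℂ × ℝ)} {n : ℕ} {f g h f' g' : ℂ × ℝ → ℝ}

theorem zero : EqJet B 0 f g := fun _ hk => absurd hk (Nat.not_lt_zero _)

theorem succ_iff : EqJet B (n + 1) f g ↔
    (∀ p ∈ B, p.1.im = 0 → f p = g p) ∧ EqJet B n (∂y f) (∂y g) := by
  constructor
  · intro H
    exact ⟨H 0 n.succ_pos, fun k hk => H (k + 1) (Nat.succ_lt_succ hk)⟩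
  · rintro ⟨H0, H⟩ (_ | k) hk
    · exact H0
    · exact H k (Nat.lt_of_succ_lt_succ hk)

theorem mono {m : ℕ} (H : EqJet B n f g) (hm : m ≤ n) : EqJet B m f g :=
  fun k hk => H k (hk.trans_le hm)

theorem symm (H : EqJet B n f g) : EqJet B n g f := fun k hk p hp h0 => (H k hk p hp h0).symm

theorem trans (H : EqJet B n f g) (H' : EqJet B n g h) : EqJet B n f h :=
  fun k hk p hp h0 => (H k hk p hp h0).trans (H' k hk p hp h0)

theorem neg (H : EqJet B n f g) : EqJet B n (-f) (-g) := by
  induction n generalizing f g with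
  | zero => exact zero
  | succ n ih =>
    rw [succ_iff] at H ⊢
    refine ⟨fun p hp h0 => by simp [H.1 p hp h0], ?_⟩
    simpa only [dirDeriv_neg] using ih H.2

theorem add (hf : ContDiff ℝ ∞ f) (hf' : ContDiff ℝ ∞ f') (hg : ContDiff ℝ ∞ g)
    (hg' : ContDiff ℝ ∞ g') (H : EqJet B n f f') (H' : EqJet B n g g') :
    EqJet B n (f + g) (f' + g') := by
  induction n generalizing f f' g g' with
  | zero => exact zero
  | succ n ih =>
    rw [succ_iff] at H H' ⊢
    refine ⟨fun p hp h0 => by simp [H.1 p hp h0, H'.1 p hp h0], ?_⟩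
    rw [dirDeriv_add hf hg, dirDeriv_add hf' hg']
    exact ih (contDiff_dirDeriv hf) (contDiff_dirDeriv hf') (contDiff_dirDeriv hg)
      (contDiff_dirDeriv hg') H.2 H'.2

theorem mul (hf : ContDiff ℝ ∞ f) (hf' : ContDiff ℝ ∞ f') (hg : ContDiff ℝ ∞ g)
    (hg' : ContDiff ℝ ∞ g') (H : EqJet B n f f') (H' : EqJet B n g g') :
    EqJet B n (f * g) (f' * g') := by
  induction n generalizing f f' g g' with
  | zero => exact zero
  | succ n ih =>
    have H1 := H.mono n.le_succ
    have H1' := H'.mono n.le_succ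
    rw [succ_iff] at H H' ⊢
    refine ⟨fun p hp h0 => by simp [H.1 p hp h0, H'.1 p hp h0], ?_⟩
    rw [dirDeriv_mul hf hg, dirDeriv_mul hf' hg']
    have cf := contDiff_dirDeriv (v := (Complex.I, 0)) hf
    have cf' := contDiff_dirDeriv (v := (Complex.I, 0)) hf'
    have cg := contDiff_dirDeriv (v := (Complex.I, 0)) hg
    have cg' := contDiff_dirDeriv (v := (Complex.I, 0)) hg'
    exact add (cf.mul hg) (cf'.mul hg') (hf.mul cg) (hf'.mul cg')
      (ih cf cf' hg hg' H.2 H1') (ih hf hf' cg cg' H1 H'.2)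

/-- Derivatives in directions tangent to `y = 0` respect equality of jets. -/
theorem dirDeriv_tangent (hB : IsOpen B) {v : ℂ × ℝ} (hv : v.1.im = 0) (hf : ContDiff ℝ ∞ f)
    (hg : ContDiff ℝ ∞ g) (H : EqJet B n f g) : EqJet B n (dirDeriv v f) (dirDeriv v g) := by
  induction n generalizing f g with
  | zero => exact zero
  | succ n ih =>
    rw [succ_iff] at H ⊢
    constructor
    · intro p hp h0
      have key : ∀ {φ : ℂ × ℝ → ℝ}, ContDiff ℝ ∞ φ →
          HasDerivAt (fun t : ℝ => φ (p + t • v)) (dirDeriv v φ p) 0 := by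
        intro φ hφ
        have h1 : HasDerivAt (fun t : ℝ => p + t • v) v 0 := by
          simpa using ((hasDerivAt_id (0 : ℝ)).smul_const v).const_add p
        have h2 : HasFDerivAt φ (fderiv ℝ φ p) (p + (0 : ℝ) • v) := by
          simpa using (hφ.differentiable (by simp) p).hasFDerivAt
        exact h2.comp_hasDerivAt (0 : ℝ) h1
      refine (key hf).unique ((key hg).congr_of_eventuallyEq ?_)
      have hc : ContinuousAt (fun t : ℝ => p + t • v) 0 := by fun_prop
      filter_upwards [hc.preimage_mem_nhds (hB.mem_nhds (by simpa using hp))] with t ht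
      exact H.1 _ ht (by simp [h0, hv])
    -- The derivative along `v` commutes with `∂y`, so the induction hypothesis applies to `∂y f`
    -- and `∂y g`.
    · rw [dirDeriv_comm hf, dirDeriv_comm hg]
      exact ih (contDiff_dirDeriv hf) (contDiff_dirDeriv hg) H.2

theorem const_mul (c : ℝ) (hf : ContDiff ℝ ∞ f) (hg : ContDiff ℝ ∞ g) (H : EqJet B n f g) :
    EqJet B n ((fun _ => c) * f) ((fun _ => c) * g) :=
  mul contDiff_const contDiff_const hf hg (fun _ _ _ _ _ => rfl) H

/-- An arbitrary direction has a `∂y` component, which costs one order; the other two components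
cost none. -/
theorem dirDeriv (hB : IsOpen B) (hf : ContDiff ℝ ∞ f) (hg : ContDiff ℝ ∞ g)
    (H : EqJet B (n + 1) f g) (v : ℂ × ℝ) : EqJet B n (dirDeriv v f) (dirDeriv v g) := by
  have key : ∀ φ, _root_.dirDeriv v φ = (fun _ => v.1.re) * ∂x φ + ((fun _ => v.1.im) * ∂y φ
      + (fun _ => v.2) * ∂u φ) := by
    intro φ
    funext p
    simp only [_root_.dirDeriv, Pi.add_apply, Pi.mul_apply]
    rw [fderiv_apply_eq, add_assoc]
    rfl
  have c : ∀ {φ} (w : ℂ × ℝ) (a : ℝ), ContDiff ℝ ∞ φ →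
      ContDiff ℝ ∞ ((fun _ => a) * _root_.dirDeriv w φ) :=
    fun w a hφ => contDiff_const.mul (contDiff_dirDeriv hφ)
  have hx := (H.mono n.le_succ).dirDeriv_tangent hB (v := (1, 0)) (by simp) hf hg
  have hu := (H.mono n.le_succ).dirDeriv_tangent hB (v := (0, 1)) (by simp) hf hg
  have hy := (succ_iff.1 H).2
  rw [key f, key g]
  exact add (c _ _ hf) (c _ _ hg) ((c _ _ hf).add (c _ _ hf)) ((c _ _ hg).add (c _ _ hg))
    (const_mul _ (contDiff_dirDeriv hf) (contDiff_dirDeriv hg) hx)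
    (add (c _ _ hf) (c _ _ hg) (c _ _ hf) (c _ _ hg)
      (const_mul _ (contDiff_dirDeriv hf) (contDiff_dirDeriv hg) hy)
      (const_mul _ (contDiff_dirDeriv hf) (contDiff_dirDeriv hg) hu))

/-- Smooth functions that agree on an open set adherent to `y = 0` have the same jets there. -/
theorem of_eqOn (hO : IsOpen O) (hcl : ∀ p ∈ B, p.1.im = 0 → p ∈ closure O)
    (hf : ContDiff ℝ ∞ f) (hg : ContDiff ℝ ∞ g) (H : Set.EqOn f g O) : EqJet B n f g := by
  induction n generalizing f g with
  | zero => exact zero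
  | succ n ih =>
    rw [succ_iff]
    refine ⟨fun p hp h0 => (H.closure hf.continuous hg.continuous) (hcl p hp h0), ?_⟩
    refine ih (contDiff_dirDeriv hf) (contDiff_dirDeriv hg) fun p hp => ?_
    exact (dirDeriv_eq_of_eventuallyEq (H.eventuallyEq_of_mem (hO.mem_nhds hp))).eq_of_nhds

end EqJet

/-! ### Smooth gluing across y = 0. -/

/-- The function equal to `f` where `0 ≤ y` and to `g` where `y < 0`. -/
noncomputable def glue (f g : ℂ × ℝ → ℝ) : ℂ × ℝ → ℝ :=
  fun p => open scoped Classical in if 0 ≤ p.1.im then f p else g p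

section Glue

variable {B : Set (ℂ × ℝ)} {f g : ℂ × ℝ → ℝ} {p : ℂ × ℝ}

theorem glue_eventuallyEq_of_pos (hp : 0 < p.1.im) : glue f g =ᶠ[𝓝 p] f := by
  have : ∀ᶠ q : ℂ × ℝ in 𝓝 p, 0 < q.1.im :=
    (Complex.continuous_im.comp continuous_fst).continuousAt.eventually (lt_mem_nhds hp)
  filter_upwards [this] with q hq
  simp [glue, hq.le]

theorem glue_eventuallyEq_of_neg (hp : p.1.im < 0) : glue f g =ᶠ[𝓝 p] g := by
  have : ∀ᶠ q : ℂ × ℝ in 𝓝 p, q.1.im < 0 :=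
    (Complex.continuous_im.comp continuous_fst).continuousAt.eventually (gt_mem_nhds hp)
  filter_upwards [this] with q hq
  simp [glue, hq]

/-- Order 2 means equality of the values and of the first y-derivatives. Tangential derivatives then
agree as well, so the full differentials coincide on y = 0. -/
theorem glue_hasFDerivAt (hB : IsOpen B) (hf : ContDiff ℝ ∞ f) (hg : ContDiff ℝ ∞ g)
    (H : EqJet B 2 f g) (hp : p ∈ B) :
    HasFDerivAt (glue f g) (if 0 ≤ p.1.im then fderiv ℝ f p else fderiv ℝ g p) p := by
  have hfd := (hf.differentiable (by simp) p).hasFDerivAt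
  have hgd := (hg.differentiable (by simp) p).hasFDerivAt
  rcases lt_trichotomy p.1.im 0 with h | h | h
  · rw [if_neg h.not_ge]
    exact hgd.congr_of_eventuallyEq (glue_eventuallyEq_of_neg h)
  · have hval : f p = g p := H 0 (by norm_num) p hp h
    have hder : fderiv ℝ g p = fderiv ℝ f p := by
      refine ContinuousLinearMap.ext fun v => ?_
      have h1 := (H.mono one_le_two).dirDeriv_tangent hB (v := (1, 0)) (by simp) hf hg 0
        one_pos p hp h
      have h2 := (H.mono one_le_two).dirDeriv_tangent hB (v := (0, 1)) (by simp) hf hg 0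
        one_pos p hp h
      have h3 := H 1 one_lt_two p hp h
      simp only [Function.iterate_zero, Function.iterate_one, id_eq] at h1 h2 h3
      rw [fderiv_apply_eq, fderiv_apply_eq f, h1, h2, h3]
    have hu : {q : ℂ × ℝ | 0 ≤ q.1.im} ∪ {q : ℂ × ℝ | q.1.im ≤ 0} = Set.univ := by
      ext q; simpa using le_total 0 q.1.im
    rw [if_pos h.ge, ← hasFDerivWithinAt_univ, ← hu]
    refine HasFDerivWithinAt.union ?_ ?_
    · refine hfd.hasFDerivWithinAt.congr (fun q (hq : 0 ≤ q.1.im) => by simp [glue, hq]) ?_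
      simp [glue, h.ge]
    · rw [hder] at hgd
      refine hgd.hasFDerivWithinAt.congr_of_eventuallyEq ?_ (by simp [glue, h.ge, hval])
      filter_upwards [self_mem_nhdsWithin, mem_nhdsWithin_of_mem_nhds (hB.mem_nhds hp)]
        with q (hq : q.1.im ≤ 0) hqB
      rcases hq.lt_or_eq with hq | hq
      · simp [glue, hq]
      · simpa [glue, hq] using H 0 two_pos q hqB hq
  · rw [if_pos h.le]
    exact hfd.congr_of_eventuallyEq (glue_eventuallyEq_of_pos h)

/-- The derivative of a glued function in a fixed direction is the gluing of the two derivatives,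
whose jets again agree to every order; this makes the induction on the differentiability class close
up. -/
theorem glue_contDiffOn (hB : IsOpen B) (hf : ContDiff ℝ ∞ f) (hg : ContDiff ℝ ∞ g)
    (H : ∀ n, EqJet B n f g) : ContDiffOn ℝ ∞ (glue f g) B := by
  rw [contDiffOn_infty]
  intro m
  induction m generalizing f g with
  | zero =>
    exact contDiffOn_zero.2 fun p hp =>
      (glue_hasFDerivAt hB hf hg (H 2) hp).continuousAt.continuousWithinAt
  | succ m ih =>
    have hd : ∀ p ∈ B, HasFDerivAt (glue f g) _ p := fun p hp => glue_hasFDerivAt hB hf hg (H 2) hp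
    push_cast
    rw [contDiffOn_succ_iff_fderiv_apply hB.uniqueDiffOn]
    refine ⟨fun p hp => (hd p hp).differentiableAt.differentiableWithinAt, by simp, fun v => ?_⟩
    refine (ih (contDiff_dirDeriv (v := v) hf) (contDiff_dirDeriv (v := v) hg)
      fun n => ?_).congr fun p hp => ?_
    · exact (H (n + 1)).dirDeriv hB hf hg v
    · rw [fderivWithin_of_isOpen hB hp, (hd p hp).fderiv]
      by_cases h : 0 ≤ p.1.im <;> simp [glue, h, dirDeriv]

end Glue

/-! ### The Levi-flatness equation of a graph. -/

/-- The real part of the slope `a` of the complex tangent line `ℂ (1, a)` of the hypersurface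
`Im w = r (z, Re w)`. -/
noncomputable def slopeRe (r : ℂ × ℝ → ℝ) : ℂ × ℝ → ℝ :=
  fun p => (∂y r p - ∂u r p * ∂x r p) / (1 + ∂u r p ^ 2)

/-- The imaginary part of the slope `a` of the complex tangent line `ℂ (1, a)` of the hypersurface
`Im w = r (z, Re w)`. -/
noncomputable def slopeIm (r : ℂ × ℝ → ℝ) : ℂ × ℝ → ℝ :=
  fun p => (∂x r p + ∂u r p * ∂y r p) / (1 + ∂u r p ^ 2)

/-- The equation expressing that the hypersurface `Im w = r (z, Re w)` is Levi-flat: its slope is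
holomorphic along the complex tangent directions. -/
def LeviEq (r : ℂ × ℝ → ℝ) (p : ℂ × ℝ) : Prop :=
  ∂y (slopeRe r) p = slopeIm r p * ∂u (slopeRe r) p - ∂x (slopeIm r) p
      - slopeRe r p * ∂u (slopeIm r) p ∧
    ∂y (slopeIm r) p = slopeIm r p * ∂u (slopeIm r) p + ∂x (slopeRe r) p
      + slopeRe r p * ∂u (slopeRe r) p

section Slope

variable {r s : ℂ × ℝ → ℝ} {p : ℂ × ℝ}

theorem one_add_sq_ne_zero_real (a : ℝ) : 1 + a ^ 2 ≠ 0 := by positivity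

theorem contDiff_slopeRe (hr : ContDiff ℝ ∞ r) : ContDiff ℝ ∞ (slopeRe r) :=
  ((contDiff_dirDeriv hr).sub ((contDiff_dirDeriv hr).mul (contDiff_dirDeriv hr))).div
    (contDiff_const.add ((contDiff_dirDeriv hr).pow 2)) fun _ => one_add_sq_ne_zero_real _

theorem contDiff_slopeIm (hr : ContDiff ℝ ∞ r) : ContDiff ℝ ∞ (slopeIm r) :=
  ((contDiff_dirDeriv hr).add ((contDiff_dirDeriv hr).mul (contDiff_dirDeriv hr))).div
    (contDiff_const.add ((contDiff_dirDeriv hr).pow 2)) fun _ => one_add_sq_ne_zero_real _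

/-- This is the tangency of the direction (i, ia) to the graph. It is the evolution equation in y
for `r` itself, completing the two equations of `LeviEq`. -/
theorem dirDeriv_y_eq (r : ℂ × ℝ → ℝ) : ∂y r = slopeRe r + slopeIm r * ∂u r := by
  funext p
  have := one_add_sq_ne_zero_real (∂u r p)
  simp only [slopeRe, slopeIm, Pi.add_apply, Pi.mul_apply]
  field_simp
  ring

theorem slopeRe_congr (h : r =ᶠ[𝓝 p] s) : slopeRe r =ᶠ[𝓝 p] slopeRe s := by
  filter_upwards [dirDeriv_eq_of_eventuallyEq h (v := (1, 0)),
    dirDeriv_eq_of_eventuallyEq h (v := (Complex.I, 0)),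
    dirDeriv_eq_of_eventuallyEq h (v := (0, 1))] with q h1 h2 h3
  simp only [slopeRe, h1, h2, h3]

theorem slopeIm_congr (h : r =ᶠ[𝓝 p] s) : slopeIm r =ᶠ[𝓝 p] slopeIm s := by
  filter_upwards [dirDeriv_eq_of_eventuallyEq h (v := (1, 0)),
    dirDeriv_eq_of_eventuallyEq h (v := (Complex.I, 0)),
    dirDeriv_eq_of_eventuallyEq h (v := (0, 1))] with q h1 h2 h3
  simp only [slopeIm, h1, h2, h3]

theorem LeviEq.congr (h : r =ᶠ[𝓝 p] s) (H : LeviEq s p) : LeviEq r p := by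
  have hα := slopeRe_congr h
  have hβ := slopeIm_congr h
  have dα := fun v => (dirDeriv_eq_of_eventuallyEq hα (v := v)).eq_of_nhds
  have dβ := fun v => (dirDeriv_eq_of_eventuallyEq hβ (v := v)).eq_of_nhds
  simpa only [LeviEq, dα, dβ, hα.eq_of_nhds, hβ.eq_of_nhds] using H

/-- The Levi-flatness equation is a closed condition. -/
theorem isClosed_leviEq (hr : ContDiff ℝ ∞ r) : IsClosed {p | LeviEq r p} := by
  have ca := (contDiff_slopeRe hr).continuous
  have cb := (contDiff_slopeIm hr).continuous
  have da := fun v => (contDiff_dirDeriv (v := v) (contDiff_slopeRe hr)).continuous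
  have db := fun v => (contDiff_dirDeriv (v := v) (contDiff_slopeIm hr)).continuous
  refine IsClosed.inter (isClosed_eq (da _) ?_) (isClosed_eq (db _) ?_)
  · exact ((cb.mul (da _)).sub (db _)).sub (ca.mul (db _))
  · exact ((cb.mul (db _)).add (da _)).add (ca.mul (da _))

end Slope

/-! ### Reflection of a graph. -/

/-- The reflection `(z, u) ↦ (z̄, u)` of `ℂ × ℝ`. -/
noncomputable def baseConj : (ℂ × ℝ) ≃L[ℝ] (ℂ × ℝ) :=
  Complex.conjCLE.prodCongr (ContinuousLinearEquiv.refl ℝ ℝ)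

theorem baseConj_apply (p : ℂ × ℝ) : baseConj p = (starRingEnd ℂ p.1, p.2) := rfl

@[simp] theorem baseConj_fst_im (p : ℂ × ℝ) : (baseConj p).1.im = -p.1.im := by
  simp [baseConj_apply]

theorem baseConj_of_im_eq_zero {p : ℂ × ℝ} (hp : p.1.im = 0) : baseConj p = p :=
  Prod.ext (Complex.conj_eq_iff_im.2 hp) rfl

section Reflect

variable {r : ℂ × ℝ → ℝ}

theorem dirDeriv_comp_baseConj (v : ℂ × ℝ) (f : ℂ × ℝ → ℝ) (p : ℂ × ℝ) :
    dirDeriv v (f ∘ baseConj) p = dirDeriv (baseConj v) f (baseConj p) := by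
  simp [dirDeriv, ContinuousLinearEquiv.comp_right_fderiv]

theorem dx_comp_baseConj (f : ℂ × ℝ → ℝ) (p : ℂ × ℝ) :
    ∂x (f ∘ baseConj) p = ∂x f (baseConj p) := by
  simp [dirDeriv_comp_baseConj, baseConj_apply]

theorem du_comp_baseConj (f : ℂ × ℝ → ℝ) (p : ℂ × ℝ) :
    ∂u (f ∘ baseConj) p = ∂u f (baseConj p) := by
  simp [dirDeriv_comp_baseConj, baseConj_apply]

theorem dy_comp_baseConj (f : ℂ × ℝ → ℝ) (p : ℂ × ℝ) :
    ∂y (f ∘ baseConj) p = -∂y f (baseConj p) := by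
  rw [dirDeriv_comp_baseConj]
  have : baseConj (Complex.I, 0) = -((Complex.I, 0) : ℂ × ℝ) := by simp [baseConj_apply]
  rw [this]
  exact map_neg _ _

/-- The function whose graph is the conjugate of the graph of `r`. -/
noncomputable def reflect (r : ℂ × ℝ → ℝ) : ℂ × ℝ → ℝ := -(r ∘ baseConj)

theorem contDiff_reflect (hr : ContDiff ℝ ∞ r) : ContDiff ℝ ∞ (reflect r) :=
  (hr.comp baseConj.contDiff).neg

theorem slopeRe_reflect (r : ℂ × ℝ → ℝ) : slopeRe (reflect r) = slopeRe r ∘ baseConj := by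
  funext p
  simp [slopeRe, reflect, dirDeriv_neg, dx_comp_baseConj, dy_comp_baseConj, du_comp_baseConj]

theorem slopeIm_reflect (r : ℂ × ℝ → ℝ) : slopeIm (reflect r) = -(slopeIm r ∘ baseConj) := by
  funext p
  simp [slopeIm, reflect, dirDeriv_neg, dx_comp_baseConj, dy_comp_baseConj, du_comp_baseConj]
  ring

/-- Under reflection `slopeRe` is even, `slopeIm` is odd and `∂y` changes sign; both sides of the
first equation change sign, and those of the second keep theirs. -/
theorem LeviEq.reflect {p : ℂ × ℝ} (H : LeviEq r (baseConj p)) : LeviEq (reflect r) p := by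
  obtain ⟨h1, h2⟩ := H
  refine ⟨?_, ?_⟩
  · simp only [slopeRe_reflect, slopeIm_reflect, dirDeriv_neg, Pi.neg_apply, dx_comp_baseConj,
      dy_comp_baseConj, du_comp_baseConj, Function.comp_apply]
    linarith
  · simp only [slopeRe_reflect, slopeIm_reflect, dirDeriv_neg, Pi.neg_apply, dx_comp_baseConj,
      dy_comp_baseConj, du_comp_baseConj, Function.comp_apply]
    linarith

end Reflect

/-! ### Equality of the jets of a solution and of its reflection. -/

theorem mem_closure_inter_im_pos {B : Set (ℂ × ℝ)} (hB : IsOpen B) {p : ℂ × ℝ} (hp : p ∈ B)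
    (h0 : p.1.im = 0) : p ∈ closure (B ∩ {q | 0 < q.1.im}) := by
  have ht : Filter.Tendsto (fun t : ℝ => p + t • ((Complex.I, 0) : ℂ × ℝ)) (𝓝[>] 0) (𝓝 p) := by
    have : Continuous fun t : ℝ => p + t • ((Complex.I, 0) : ℂ × ℝ) := by fun_prop
    simpa using (this.tendsto 0).mono_left nhdsWithin_le_nhds
  refine mem_closure_of_tendsto ht ?_
  filter_upwards [ht (hB.mem_nhds hp), self_mem_nhdsWithin] with t h1 h2
  exact ⟨h1, by simpa [h0] using h2⟩

theorem mem_closure_inter_im_neg {B : Set (ℂ × ℝ)} (hB : IsOpen B) {p : ℂ × ℝ} (hp : p ∈ B)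
    (h0 : p.1.im = 0) : p ∈ closure (B ∩ {q | q.1.im < 0}) := by
  have ht : Filter.Tendsto (fun t : ℝ => p + t • ((Complex.I, 0) : ℂ × ℝ)) (𝓝[<] 0) (𝓝 p) := by
    have : Continuous fun t : ℝ => p + t • ((Complex.I, 0) : ℂ × ℝ) := by fun_prop
    simpa using (this.tendsto 0).mono_left nhdsWithin_le_nhds
  refine mem_closure_of_tendsto ht ?_
  filter_upwards [ht (hB.mem_nhds hp), self_mem_nhdsWithin] with t h1 h2
  exact ⟨h1, by simpa [h0] using h2⟩

section Jets

variable {r s : ℂ × ℝ → ℝ} {B O : Set (ℂ × ℝ)} {n : ℕ}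

theorem dirDeriv_tangent_eq_zero (hB : IsOpen B) {v : ℂ × ℝ} (hv : v.1.im = 0)
    (hr : ContDiff ℝ ∞ r) (h0 : ∀ p ∈ B, p.1.im = 0 → r p = 0) :
    ∀ p ∈ B, p.1.im = 0 → dirDeriv v r p = 0 := by
  intro p hp hy
  have : EqJet B 1 r 0 := EqJet.succ_iff.2 ⟨h0, EqJet.zero⟩
  simpa [dirDeriv] using this.dirDeriv_tangent hB hv hr contDiff_const 0 one_pos p hp hy

/-- Each term of the numerator contains a tangential derivative of `r`, which vanishes where `r`
vanishes identically along y = 0. -/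
theorem slopeIm_eq_zero (hB : IsOpen B) (hr : ContDiff ℝ ∞ r)
    (h0 : ∀ p ∈ B, p.1.im = 0 → r p = 0) : ∀ p ∈ B, p.1.im = 0 → slopeIm r p = 0 := by
  intro p hp hy
  simp [slopeIm, dirDeriv_tangent_eq_zero hB (v := (1, 0)) (by simp) hr h0 p hp hy,
    dirDeriv_tangent_eq_zero hB (v := (0, 1)) (by simp) hr h0 p hp hy]

/-- The equation is only known on one side `O` of y = 0, but both of its sides are smooth
everywhere, so by continuity it may be differentiated in y any number of times at the points of y =
0. -/
theorem leviEq_eqJet (hO : IsOpen O) (hcl : ∀ p ∈ B, p.1.im = 0 → p ∈ closure O)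
    (hr : ContDiff ℝ ∞ r) (H : ∀ p ∈ O, LeviEq r p) :
    EqJet B n (∂y (slopeRe r)) (slopeIm r * ∂u (slopeRe r) + -∂x (slopeIm r)
      + -(slopeRe r * ∂u (slopeIm r))) ∧
    EqJet B n (∂y (slopeIm r)) (slopeIm r * ∂u (slopeIm r) + ∂x (slopeRe r)
      + slopeRe r * ∂u (slopeRe r)) := by
  have ca := contDiff_slopeRe hr
  have cb := contDiff_slopeIm hr
  have da := fun v => contDiff_dirDeriv (v := v) ca
  have db := fun v => contDiff_dirDeriv (v := v) cb
  constructor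
  · refine EqJet.of_eqOn hO hcl (da _)
      (((cb.mul (da _)).add (db _).neg).add (ca.mul (db _)).neg) fun p hp => ?_
    simp [(H p hp).1, sub_eq_add_neg]
  · refine EqJet.of_eqOn hO hcl (db _) (((cb.mul (db _)).add (da _)).add (ca.mul (da _)))
      fun p hp => ?_
    simp [(H p hp).2]

/-- If `r` vanishes for `y = 0` and satisfies the Levi-flatness equation for `y > 0`, then its jets
along `y = 0` are those of its reflection. -/
theorem eqJet_reflect (hB : IsOpen B) (hσ : ∀ p ∈ B, baseConj p ∈ B) (hr : ContDiff ℝ ∞ r)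
    (h0 : ∀ p ∈ B, p.1.im = 0 → r p = 0) (H : ∀ p ∈ B, 0 < p.1.im → LeviEq r p) (n : ℕ) :
    EqJet B n r (reflect r) := by
  set s := reflect r with hs_def
  have hs : ContDiff ℝ ∞ s := contDiff_reflect hr
  have hs0 : ∀ p ∈ B, p.1.im = 0 → s p = 0 := fun p hp hy => by
    simp [hs_def, reflect, baseConj_of_im_eq_zero hy, h0 p hp hy]
  have Hs : ∀ p ∈ B, p.1.im < 0 → LeviEq s p := fun p hp hy =>
    (H _ (hσ p hp) (by simpa using hy)).reflect
  have him : Continuous fun q : ℂ × ℝ => q.1.im := by fun_prop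
  have er := fun m => leviEq_eqJet (n := m) (hB.inter (isOpen_lt continuous_const him))
    (fun p hp hy => mem_closure_inter_im_pos hB hp hy) hr fun p hp => H p hp.1 hp.2
  have es := fun m => leviEq_eqJet (n := m) (hB.inter (isOpen_lt him continuous_const))
    (fun p hp hy => mem_closure_inter_im_neg hB hp hy) hs fun p hp => Hs p hp.1 hp.2
  have ca := contDiff_slopeRe hr
  have cb := contDiff_slopeIm hr
  have ca' := contDiff_slopeRe hs
  have cb' := contDiff_slopeIm hs
  have D := fun {f : ℂ × ℝ → ℝ} (hf : ContDiff ℝ ∞ f) v => contDiff_dirDeriv (v := v) hf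
  -- The three functions have to be carried together: the y-derivative of each is a polynomial in
  -- the three and their tangential derivatives, which the induction hypothesis controls to the same
  -- order.
  suffices ∀ n, EqJet B n r s ∧ EqJet B n (slopeRe r) (slopeRe s) ∧
      EqJet B n (slopeIm r) (slopeIm s) from (this n).1
  intro n
  induction n with
  | zero => exact ⟨EqJet.zero, EqJet.zero, EqJet.zero⟩
  | succ n ih =>
    obtain ⟨jr, ja, jb⟩ := ih
    have tx : ((1, 0) : ℂ × ℝ).1.im = 0 := by simp
    have tu : ((0, 1) : ℂ × ℝ).1.im = 0 := by simp
    have jru := jr.dirDeriv_tangent hB tu hr hs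
    have jax := ja.dirDeriv_tangent hB tx ca ca'
    have jau := ja.dirDeriv_tangent hB tu ca ca'
    have jbx := jb.dirDeriv_tangent hB tx cb cb'
    have jbu := jb.dirDeriv_tangent hB tu cb cb'
    refine ⟨EqJet.succ_iff.2 ⟨fun p hp hy => ?_, ?_⟩, EqJet.succ_iff.2 ⟨fun p hp hy => ?_, ?_⟩,
      EqJet.succ_iff.2 ⟨fun p hp hy => ?_, ?_⟩⟩
    · rw [h0 p hp hy, hs0 p hp hy]
    · rw [dirDeriv_y_eq r, dirDeriv_y_eq s]
      exact ja.add ca ca' (cb.mul (D hr _)) (cb'.mul (D hs _)) (jb.mul cb cb' (D hr _) (D hs _) jru)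
    -- The real part of the slope is even under reflection, which fixes the points of y = 0.
    · simp [hs_def, slopeRe_reflect, baseConj_of_im_eq_zero hy]
    · refine (er n).1.trans (EqJet.trans ?_ (es n).1.symm)
      exact EqJet.add ((cb.mul (D ca _)).add (D cb _).neg) ((cb'.mul (D ca' _)).add (D cb' _).neg)
        (ca.mul (D cb _)).neg (ca'.mul (D cb' _)).neg
        (EqJet.add (cb.mul (D ca _)) (cb'.mul (D ca' _)) (D cb _).neg (D cb' _).neg
          (jb.mul cb cb' (D ca _) (D ca' _) jau) jbx.neg)
        (ja.mul ca ca' (D cb _) (D cb' _) jbu).neg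
    · rw [slopeIm_eq_zero hB hr h0 p hp hy, slopeIm_eq_zero hB hs hs0 p hp hy]
    · refine (er n).2.trans (EqJet.trans ?_ (es n).2.symm)
      exact EqJet.add ((cb.mul (D cb _)).add (D ca _)) ((cb'.mul (D cb' _)).add (D ca' _))
        (ca.mul (D ca _)) (ca'.mul (D ca' _))
        (EqJet.add (cb.mul (D cb _)) (cb'.mul (D cb' _)) (D ca _) (D ca' _)
          (jb.mul cb cb' (D cb _) (D cb' _) jbu) jax)
        (ja.mul ca ca' (D ca _) (D ca' _) jau)

end Jets

/-! ### Smooth extension, and the slope as a complex function. -/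

/-- A function that is smooth near a point agrees near that point with a globally smooth one. -/
theorem exists_contDiff_eventuallyEq {E : Type*} [NormedAddCommGroup E] [NormedSpace ℝ E]
    [FiniteDimensional ℝ E] {f : E → ℝ} {N : Set E} {x : E} (hN : IsOpen N) (hx : x ∈ N)
    (hf : ContDiffOn ℝ ∞ f N) : ∃ g : E → ℝ, ContDiff ℝ ∞ g ∧ g =ᶠ[𝓝 x] f := by
  obtain ⟨ε, hε, hball⟩ := Metric.isOpen_iff.1 hN x hx
  let χ : ContDiffBump x := ⟨ε / 3, ε / 2, by positivity, by linarith⟩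
  refine ⟨fun y => χ y * f y, ?_, ?_⟩
  · refine contDiff_iff_contDiffAt.2 fun y => ?_
    by_cases hy : y ∈ N
    · exact χ.contDiff.contDiffAt.mul (hf.contDiffAt (hN.mem_nhds hy))
    · have : y ∉ tsupport χ := by
        rw [χ.tsupport_eq]
        intro h
        exact hy (hball (Metric.closedBall_subset_ball (half_lt_self hε) h))
      have h0 : (fun y => χ y * f y) =ᶠ[𝓝 y] fun _ => 0 := by
        filter_upwards [(notMem_tsupport_iff_eventuallyEq.1 this)] with z hz
        simp [hz]
      exact contDiffAt_const.congr_of_eventuallyEq h0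
  · filter_upwards [χ.eventuallyEq_one] with y hy
    simp [hy]

/-- The projection `(z, w) ↦ (z, Re w)`. -/
noncomputable def baseProj : (ℂ × ℂ) →L[ℝ] (ℂ × ℝ) :=
  (ContinuousLinearMap.fst ℝ ℂ ℂ).prod (Complex.reCLM.comp (ContinuousLinearMap.snd ℝ ℂ ℂ))

theorem baseProj_apply (p : ℂ × ℂ) : baseProj p = (p.1, p.2.re) := rfl

/-- The slope `a` of the complex tangent line `ℂ (1, a)` of the hypersurface
`Im w = r (z, Re w)`. -/
noncomputable def leviSlope (r : ℂ × ℝ → ℝ) (p : ℂ × ℝ) : ℂ := slopeRe r p + slopeIm r p * Complex.I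

section Slope

variable {r : ℂ × ℝ → ℝ}

@[simp] theorem leviSlope_re (p : ℂ × ℝ) : (leviSlope r p).re = slopeRe r p := by simp [leviSlope]

@[simp] theorem leviSlope_im (p : ℂ × ℝ) : (leviSlope r p).im = slopeIm r p := by simp [leviSlope]

theorem contDiff_leviSlope (hr : ContDiff ℝ ∞ r) : ContDiff ℝ ∞ (leviSlope r) :=
  (Complex.ofRealCLM.contDiff.comp (contDiff_slopeRe hr)).add
    ((Complex.ofRealCLM.contDiff.comp (contDiff_slopeIm hr)).mul contDiff_const)

theorem fderiv_leviSlope_re (hr : ContDiff ℝ ∞ r) (p v : ℂ × ℝ) :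
    (fderiv ℝ (leviSlope r) p v).re = fderiv ℝ (slopeRe r) p v := by
  have h := Complex.reCLM.hasFDerivAt.comp p
    ((contDiff_leviSlope hr).differentiable (by simp) p).hasFDerivAt
  have : Complex.reCLM ∘ leviSlope r = slopeRe r := funext fun q => by simp
  rw [this] at h
  rw [h.fderiv]
  rfl

theorem fderiv_leviSlope_im (hr : ContDiff ℝ ∞ r) (p v : ℂ × ℝ) :
    (fderiv ℝ (leviSlope r) p v).im = fderiv ℝ (slopeIm r) p v := by
  have h := Complex.imCLM.hasFDerivAt.comp p
    ((contDiff_leviSlope hr).differentiable (by simp) p).hasFDerivAt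
  have : Complex.imCLM ∘ leviSlope r = slopeIm r := funext fun q => by simp
  rw [this] at h
  rw [h.fderiv]
  rfl

/-- The two real equations are the Cauchy–Riemann equation along the complex tangent line: its
vectors (1, a) and (i, ia) project to the two directions used here. -/
theorem leviEq_iff (hr : ContDiff ℝ ∞ r) (p : ℂ × ℝ) :
    LeviEq r p ↔ fderiv ℝ (leviSlope r) p (Complex.I, (leviSlope r p * Complex.I).re) =
      Complex.I * fderiv ℝ (leviSlope r) p (1, (leviSlope r p).re) := by
  rw [Complex.ext_iff]
  simp only [Complex.mul_re, Complex.mul_im, fderiv_leviSlope_re hr, fderiv_leviSlope_im hr,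
    fderiv_apply_eq, leviSlope_re, leviSlope_im, Complex.I_re, Complex.I_im, Complex.one_re,
    Complex.one_im, LeviEq]
  constructor
  · rintro ⟨h1, h2⟩
    constructor <;> linarith
  · rintro ⟨h1, h2⟩
    constructor <;> linarith

theorem LeviEq.fderiv_leviSlope (hr : ContDiff ℝ ∞ r) {p : ℂ × ℝ} (H : LeviEq r p) (ζ : ℂ) :
    fderiv ℝ (leviSlope r) p (ζ, (leviSlope r p * ζ).re) =
      ζ * fderiv ℝ (leviSlope r) p (1, (leviSlope r p).re) := by
  have hζ : ((ζ, (leviSlope r p * ζ).re) : ℂ × ℝ) = ζ.re • ((1, (leviSlope r p).re) : ℂ × ℝ)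
      + ζ.im • ((Complex.I, (leviSlope r p * Complex.I).re) : ℂ × ℝ) := by
    ext <;> simp
    ring
  rw [hζ, map_add, map_smul, map_smul, (leviEq_iff hr p).1 H]
  conv_rhs => rw [← Complex.re_add_im ζ]
  simp only [Complex.real_smul]
  ring

end Slope

/-! ### Tangent spaces and Levi-flatness of graphs. -/

theorem fderiv_eq_zero_of_mem_tangentVectors {F : Type*} [NormedAddCommGroup F] [NormedSpace ℝ F]
    {S : Set (ℂ × ℂ)} {p v : ℂ × ℂ} {h : ℂ × ℂ → F} (hv : v ∈ tangentVectors S p)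
    (hd : DifferentiableAt ℝ h p) (h0 : ∀ᶠ q in 𝓝 p, q ∈ S → h q = 0) : fderiv ℝ h p v = 0 := by
  obtain ⟨γ, hγ, rfl, hS, rfl⟩ := hv
  have h1 : HasDerivAt (h ∘ γ) (fderiv ℝ h (γ 0) (deriv γ 0)) 0 :=
    hd.hasFDerivAt.comp_hasDerivAt 0 (hγ.differentiableAt (by simp)).hasDerivAt
  refine h1.unique ((hasDerivAt_const (0 : ℝ) (0 : F)).congr_of_eventuallyEq ?_)
  filter_upwards [hS, hγ.continuousAt.eventually h0] with t h1 h2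
  exact h2 h1

/-- Near `p`, the set `S` is the hypersurface `Im w = r (z, Re w)`. -/
def IsGraphNear (S : Set (ℂ × ℂ)) (r : ℂ × ℝ → ℝ) (p : ℂ × ℂ) : Prop :=
  ∀ᶠ q in 𝓝 p, (q ∈ S ↔ q.2.im = r (baseProj q))

section Graph

variable {S : Set (ℂ × ℂ)} {r : ℂ × ℝ → ℝ} {p : ℂ × ℂ}

theorem IsGraphNear.mem_tangentVectors_iff (hr : ContDiff ℝ ∞ r) (hS : IsGraphNear S r p)
    (hp : p ∈ S) {v : ℂ × ℂ} :
    v ∈ tangentVectors S p ↔ v.2.im = fderiv ℝ r (baseProj p) (baseProj v) := by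
  constructor
  · intro hv
    have hd : HasFDerivAt (fun q : ℂ × ℂ => q.2.im - r (baseProj q))
        ((Complex.imCLM.comp (ContinuousLinearMap.snd ℝ ℂ ℂ)) -
          (fderiv ℝ r (baseProj p)).comp baseProj) p :=
      (Complex.imCLM.comp (ContinuousLinearMap.snd ℝ ℂ ℂ)).hasFDerivAt.sub
        ((hr.differentiable (by simp) _).hasFDerivAt.comp p baseProj.hasFDerivAt)
    have := fderiv_eq_zero_of_mem_tangentVectors hv hd.differentiableAt
      (hS.mono fun q hq h => sub_eq_zero.2 (hq.1 h))
    rw [hd.fderiv] at this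
    exact sub_eq_zero.1 this
  · intro hv
    -- The required curve is the lift to the graph of a straight line in the base.
    let b : ℝ → ℂ × ℝ := fun t => baseProj p + t • baseProj v
    let γ : ℝ → ℂ × ℂ := fun t =>
      ((b t).1, ((b t).2 : ℂ) + (r (b t) : ℂ) * Complex.I)
    have hb : ContDiff ℝ ∞ b := contDiff_const.add (contDiff_id.smul contDiff_const)
    have hγ : ContDiff ℝ ∞ γ := hb.fst.prodMk
      ((Complex.ofRealCLM.contDiff.comp hb.snd).add
        ((Complex.ofRealCLM.contDiff.comp (hr.comp hb)).mul contDiff_const))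
    have hpr : p.2.im = r (baseProj p) := hS.self_of_nhds.1 hp
    have hγ0 : γ 0 = p := by
      have : b 0 = baseProj p := by simp [b]
      simp only [γ, this, ← hpr]
      exact Prod.ext rfl (Complex.re_add_im _)
    refine ⟨γ, hγ.contDiffAt, hγ0, ?_, ?_⟩
    · have hc : ContinuousAt γ 0 := hγ.continuous.continuousAt
      rw [ContinuousAt, hγ0] at hc
      filter_upwards [hc.eventually hS] with t ht
      refine ht.2 ?_
      have : baseProj (γ t) = b t := by simp [γ, baseProj_apply]
      rw [this]
      simp [γ]
    · have db : HasDerivAt b (baseProj v) 0 := by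
        have := ((hasDerivAt_id (0 : ℝ)).smul_const (baseProj v)).const_add (baseProj p)
        rw [one_smul] at this
        exact this
      have dr : HasDerivAt (r ∘ b) (fderiv ℝ r (baseProj p) (baseProj v)) 0 := by
        refine HasFDerivAt.comp_hasDerivAt (0 : ℝ) ?_ db
        have : b 0 = baseProj p := by simp [b]
        rw [this]
        exact (hr.differentiable (by simp) _).hasFDerivAt
      have d1 : HasDerivAt (fun t => (b t).1) (baseProj v).1 0 :=
        (ContinuousLinearMap.fst ℝ ℂ ℝ).hasFDerivAt.comp_hasDerivAt (0 : ℝ) db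
      have d2 : HasDerivAt (fun t => (b t).2) (baseProj v).2 0 :=
        (ContinuousLinearMap.snd ℝ ℂ ℝ).hasFDerivAt.comp_hasDerivAt (0 : ℝ) db
      have dγ := (d1.prodMk (d2.ofReal_comp.add (dr.ofReal_comp.mul_const Complex.I))).deriv
      refine dγ.trans ?_
      rw [← hv]
      exact Prod.ext rfl (Complex.re_add_im _)

theorem IsGraphNear.mem_complexTangentVectors_iff (hr : ContDiff ℝ ∞ r) (hS : IsGraphNear S r p)
    (hp : p ∈ S) {v : ℂ × ℂ} :
    v ∈ complexTangentVectors S p ↔ v.2 = leviSlope r (baseProj p) * v.1 := by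
  have hI : v ∈ (fun v => Complex.I • v) '' tangentVectors S p ↔
      (-Complex.I) • v ∈ tangentVectors S p := by
    constructor
    · rintro ⟨w, hw, rfl⟩
      simpa [smul_smul] using hw
    · intro h
      exact ⟨_, h, by simp [smul_smul]⟩
  have hk := one_add_sq_ne_zero_real (∂u r (baseProj p))
  rw [complexTangentVectors, Set.mem_inter_iff, hI, hS.mem_tangentVectors_iff hr hp,
    hS.mem_tangentVectors_iff hr hp, fderiv_apply_eq, fderiv_apply_eq, Complex.ext_iff]
  simp only [baseProj_apply, leviSlope_re, leviSlope_im, Complex.mul_re, Complex.mul_im, Prod.smul_fst,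
    Prod.smul_snd, smul_eq_mul, Complex.neg_re, Complex.neg_im, Complex.I_re, Complex.I_im,
    slopeRe, slopeIm] at hk ⊢
  generalize ∂u r (p.1, p.2.re) = k at *
  generalize ∂x r (p.1, p.2.re) = a
  generalize ∂y r (p.1, p.2.re) = b
  generalize v.1.re = x
  generalize v.1.im = y
  generalize v.2.re = s
  generalize v.2.im = t
  constructor
  · rintro ⟨h1, h2⟩
    constructor
    · field_simp
      linear_combination (-1 : ℝ) * h1 - k * h2
    · field_simp
      linear_combination h2 - k * h1
  · rintro ⟨h1, h2⟩
    rw [h1, h2]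
    constructor
    · field_simp
      ring
    · field_simp
      ring

theorem IsGraphNear.eventually (hS : IsGraphNear S r p) : ∀ᶠ q in 𝓝 p, IsGraphNear S r q :=
  eventually_eventually_nhds.2 hS

theorem hasFDerivAt_leviSlope_baseProj (hr : ContDiff ℝ ∞ r) (p : ℂ × ℂ) :
    HasFDerivAt (fun q : ℂ × ℂ => leviSlope r (baseProj q))
      ((fderiv ℝ (leviSlope r) (baseProj p)).comp baseProj) p :=
  ((contDiff_leviSlope hr).differentiable (by simp) _).hasFDerivAt.comp p baseProj.hasFDerivAt

/-- Involutivity is tested on the sections (1, a) and (i, ia). Their first components are constant,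
so the bracket is (0, ∗) and lies on the line ℂ(1, a) only if ∗ = 0, which is the equation of
`leviEq_iff`. -/
theorem IsLeviFlat.leviEq (hflat : IsLeviFlat S) (hr : ContDiff ℝ ∞ r) (hS : IsGraphNear S r p)
    (hp : p ∈ S) : LeviEq r (baseProj p) := by
  obtain ⟨V, hV, hVo, hpV⟩ := eventually_nhds_iff.1 hS.eventually
  let A : ℂ × ℂ → ℂ := fun q => leviSlope r (baseProj q)
  have hA : ContDiff ℝ ∞ A := (contDiff_leviSlope hr).comp baseProj.contDiff
  have dA := hasFDerivAt_leviSlope_baseProj hr p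
  have dX : HasFDerivAt (fun q => ((1 : ℂ), A q)) _ p := (hasFDerivAt_const (1 : ℂ) p).prodMk dA
  have dY : HasFDerivAt (fun q => (Complex.I, Complex.I * A q)) _ p :=
    (hasFDerivAt_const Complex.I p).prodMk (dA.const_mul Complex.I)
  have key := hflat V (fun q => (1, A q)) (fun q => (Complex.I, Complex.I * A q)) hVo
    (contDiff_const.prodMk hA).contDiffOn
    (contDiff_const.prodMk (contDiff_const.mul hA)).contDiffOn
    (fun q hq => ((hV q hq.2).mem_complexTangentVectors_iff hr hq.1).2 (by simp [A]))
    (fun q hq => ((hV q hq.2).mem_complexTangentVectors_iff hr hq.1).2 (by simp [A, mul_comm]))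
    p ⟨hp, hpV⟩
  rw [hS.mem_complexTangentVectors_iff hr hp, VectorField.lieBracket, dX.fderiv, dY.fderiv] at key
  simp [baseProj_apply, sub_eq_zero] at key
  rw [leviEq_iff hr]
  simpa [baseProj_apply, A] using key.symm

theorem isLeviFlat_of_leviEq (hr : ContDiff ℝ ∞ r) (hS : ∀ p ∈ S, IsGraphNear S r p)
    (H : ∀ p ∈ S, LeviEq r (baseProj p)) : IsLeviFlat S := by
  intro V X Y hV hX hY hXS hYS p hp
  let A : ℂ × ℂ → ℂ := fun q => leviSlope r (baseProj q)
  have dA : HasFDerivAt A _ p := hasFDerivAt_leviSlope_baseProj hr p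
  -- Differentiate Z₂ - aZ₁ = 0 along the tangent vector W. By holomorphy of a along the line, the
  -- error term W₁Z₁·∂a is symmetric in Z and W, so it cancels in the bracket.
  have key : ∀ {Z W : ℂ × ℂ → ℂ × ℂ}, ContDiffOn ℝ ∞ Z V →
      (∀ q ∈ S ∩ V, Z q ∈ complexTangentVectors S q) →
      (∀ q ∈ S ∩ V, W q ∈ complexTangentVectors S q) →
      (fderiv ℝ Z p (W p)).2 = A p * (fderiv ℝ Z p (W p)).1 +
        (W p).1 * (Z p).1 * fderiv ℝ (leviSlope r) (baseProj p) (1, (A p).re) := by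
    intro Z W hZ hZS hWS
    have dZ := (hZ.contDiffAt (hV.mem_nhds hp.2)).differentiableAt (by simp)
    have dZ' := dZ.hasFDerivAt
    have d2 : HasFDerivAt (fun q => (Z q).2 - A q * (Z q).1) _ p := dZ'.snd.sub (dA.mul dZ'.fst)
    have h0 := fderiv_eq_zero_of_mem_tangentVectors (hWS p hp).2 d2.differentiableAt (by
      filter_upwards [hV.mem_nhds hp.2] with q hq hqS
      exact sub_eq_zero.2
        (((hS q hqS).mem_complexTangentVectors_iff hr hqS).1 (hZS q ⟨hqS, hq⟩)))
    have hW := ((hS p hp.1).mem_complexTangentVectors_iff hr hp.1).1 (hWS p hp)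
    have hL := (H p hp.1).fderiv_leviSlope hr (W p).1
    rw [← hW] at hL
    rw [d2.fderiv] at h0
    simp only [_root_.sub_apply, _root_.add_apply,
      _root_.smul_apply, ContinuousLinearMap.comp_apply, smul_eq_mul] at h0
    have hb : baseProj (W p) = ((W p).1, (W p).2.re) := rfl
    rw [hb, hL] at h0
    simp only [ContinuousLinearMap.coe_fst', ContinuousLinearMap.coe_snd', A] at h0 ⊢
    linear_combination h0
  rw [(hS p hp.1).mem_complexTangentVectors_iff hr hp.1, VectorField.lieBracket]
  have h1 := key hX hXS hYS
  have h2 := key hY hYS hXS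
  simp only [Prod.snd_sub, Prod.fst_sub]
  rw [h1, h2]
  ring

/-- The part of a smooth graph `Im w = r (z, Re w)` in an open set is a smooth hypersurface. -/
theorem isSmoothHypersurface_graph (hr : ContDiff ℝ ∞ r) {U : Set (ℂ × ℂ)} (hU : IsOpen U) :
    IsSmoothHypersurface {q ∈ U | q.2.im = r (baseProj q)} := by
  let φ : ℂ × ℂ → Fin 4 → ℝ := fun q => ![q.1.re, q.1.im, q.2.re, q.2.im - r (baseProj q)]
  let ψ : (Fin 4 → ℝ) → ℂ × ℂ := fun x =>
    ((x 0 : ℂ) + x 1 * Complex.I,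
      (x 2 : ℂ) + (x 3 + r ((x 0 : ℂ) + x 1 * Complex.I, x 2) : ℝ) * Complex.I)
  have hφ : ContDiff ℝ ∞ φ := by
    refine contDiff_pi.2 fun i => ?_
    have h1 : ContDiff ℝ ∞ fun q : ℂ × ℂ => q.1.re := Complex.reCLM.contDiff.comp contDiff_fst
    have h2 : ContDiff ℝ ∞ fun q : ℂ × ℂ => q.1.im := Complex.imCLM.contDiff.comp contDiff_fst
    have h3 : ContDiff ℝ ∞ fun q : ℂ × ℂ => q.2.re := Complex.reCLM.contDiff.comp contDiff_snd
    have h4 : ContDiff ℝ ∞ fun q : ℂ × ℂ => q.2.im := Complex.imCLM.contDiff.comp contDiff_snd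
    fin_cases i
    · exact h1
    · exact h2
    · exact h3
    · exact h4.sub (hr.comp baseProj.contDiff)
  have hψ : ContDiff ℝ ∞ ψ := by
    have h : ∀ i, ContDiff ℝ ∞ fun x : Fin 4 → ℝ => x i := fun i => contDiff_apply ℝ ℝ i
    have hc : ∀ {f : (Fin 4 → ℝ) → ℝ}, ContDiff ℝ ∞ f → ContDiff ℝ ∞ fun x => (f x : ℂ) :=
      fun hf => Complex.ofRealCLM.contDiff.comp hf
    have hz : ContDiff ℝ ∞ fun x : Fin 4 → ℝ => (x 0 : ℂ) + x 1 * Complex.I :=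
      (hc (h 0)).add ((hc (h 1)).mul contDiff_const)
    exact hz.prodMk ((hc (h 2)).add
      ((hc ((h 3).add (hr.comp (hz.prodMk (h 2))))).mul contDiff_const))
  have hψφ : ∀ q, ψ (φ q) = q := by
    intro q
    refine Prod.ext ?_ ?_ <;> simp [ψ, φ, baseProj_apply]
  have hφψ : ∀ x, φ (ψ x) = x := by
    intro x
    funext i
    fin_cases i <;> simp [ψ, φ, baseProj_apply]
  let Φ : (ℂ × ℂ) ≃ₜ (Fin 4 → ℝ) := ⟨⟨φ, ψ, hψφ, hφψ⟩, hφ.continuous, hψ.continuous⟩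
  intro p hp
  refine ⟨Φ.toOpenPartialHomeomorphOfImageEq U hU (φ '' U) rfl, ⟨hφ.contDiffOn, hψ.contDiffOn⟩,
    hp.1, ?_⟩
  ext x
  constructor
  · rintro ⟨q, ⟨hq, -⟩, rfl⟩
    exact ⟨⟨q, hq.1, rfl⟩, sub_eq_zero.2 hq.2⟩
  · rintro ⟨⟨q, hq, rfl⟩, h⟩
    exact ⟨q, ⟨⟨hq, sub_eq_zero.1 h⟩, hq⟩, rfl⟩

end Graph

/-! ### Reflection of a half graph. -/

theorem conjC2_conjC2 (p : ℂ × ℂ) : conjC2 (conjC2 p) = p := by simp [conjC2]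

theorem mem_image_conjC2 {A : Set (ℂ × ℂ)} {p : ℂ × ℂ} : p ∈ conjC2 '' A ↔ conjC2 p ∈ A :=
  ⟨by rintro ⟨q, hq, rfl⟩; rwa [conjC2_conjC2], fun h => ⟨_, h, conjC2_conjC2 p⟩⟩

theorem conjC2_mem_ball {p : ℂ × ℂ} {ε : ℝ} :
    conjC2 p ∈ Metric.ball (0 : ℂ × ℂ) ε ↔ p ∈ Metric.ball (0 : ℂ × ℂ) ε := by
  simp [conjC2, Prod.norm_def]

theorem baseConj_mem_ball {p : ℂ × ℝ} {ε : ℝ} (hp : p ∈ Metric.ball (0 : ℂ × ℝ) ε) :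
    baseConj p ∈ Metric.ball (0 : ℂ × ℝ) ε := by
  simpa [baseConj_apply, Prod.norm_def] using hp

theorem baseProj_mem_ball {p : ℂ × ℂ} {ε : ℝ} (hp : p ∈ Metric.ball (0 : ℂ × ℂ) ε) :
    baseProj p ∈ Metric.ball (0 : ℂ × ℝ) ε := by
  simp only [Metric.mem_ball, dist_zero_right, Prod.norm_def, baseProj_apply, max_lt_iff] at hp ⊢
  exact ⟨hp.1, (Complex.abs_re_le_norm _).trans_lt hp.2⟩

section NormalForm

variable {H bH : Set (ℂ × ℂ)} {r : ℂ × ℝ → ℝ}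

/-- If `H` is, near `0`, the half `0 ≤ Im z` of the graph of `r`, then Levi-flatness of its
interior gives the Levi-flatness equation for `r` where `0 < Im z`. -/
theorem eventually_leviEq (hr : ContDiff ℝ ∞ r) (hr0 : r 0 = 0)
    (hH : ∀ᶠ p in 𝓝 (0 : ℂ × ℂ), (p ∈ H ↔ 0 ≤ p.1.im ∧ p.2.im = r (baseProj p)))
    (hbH : bH ⊆ realPlane) (hflat : IsLeviFlat (H \ bH)) :
    ∀ᶠ q in 𝓝 (0 : ℂ × ℝ), 0 < q.1.im → LeviEq r q := by
  let lift : ℂ × ℝ → ℂ × ℂ := fun q => (q.1, (q.2 : ℂ) + (r q : ℂ) * Complex.I)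
  have hrc := hr.continuous
  have hl : Continuous lift := by fun_prop
  have hl0 : lift 0 = 0 := by simp [lift, hr0]
  have := hl.continuousAt (x := 0)
  rw [ContinuousAt, hl0] at this
  filter_upwards [this.eventually (eventually_eventually_nhds.2 hH)] with q hq hy
  have hb : baseProj (lift q) = q := by simp [baseProj_apply, lift]
  have hpos : ∀ᶠ p : ℂ × ℂ in 𝓝 (lift q), 0 < p.1.im :=
    (Complex.continuous_im.comp continuous_fst).continuousAt.eventually (lt_mem_nhds hy)
  have hG : IsGraphNear (H \ bH) r (lift q) := by
    filter_upwards [hq, hpos] with p hp hp0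
    have : p ∉ bH := fun h => hp0.ne' (hbH h).1
    simp [hp, this, hp0.le]
  rw [← hb]
  refine hflat.leviEq hr hG (hG.self_of_nhds.2 ?_)
  rw [hb]
  simp [lift]

theorem exists_reflection_of_graph (hr : ContDiff ℝ ∞ r)
    (hr0 : ∀ᶠ q in 𝓝 (0 : ℂ × ℝ), q.1.im = 0 → r q = 0)
    (hH : ∀ᶠ p in 𝓝 (0 : ℂ × ℂ), (p ∈ H ↔ 0 ≤ p.1.im ∧ p.2.im = r (baseProj p)))
    (hbH : bH ⊆ realPlane) (hflat : IsLeviFlat (H \ bH)) :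
    ∃ U : Set (ℂ × ℂ), IsOpen U ∧ (0 : ℂ × ℂ) ∈ U ∧ U = conjC2 '' U ∧
      IsSmoothHypersurface ((H ∩ U) ∪ conjC2 '' (H ∩ U)) ∧
      IsLeviFlat ((H ∩ U) ∪ conjC2 '' (H ∩ U)) := by
  have hL := eventually_leviEq hr (hr0.self_of_nhds (by simp)) hH hbH hflat
  obtain ⟨δ, hδ, hδB⟩ := Metric.eventually_nhds_iff_ball.1 (hr0.and hL)
  have hjet := eqJet_reflect Metric.isOpen_ball (fun p => baseConj_mem_ball) hr
    (fun p hp => (hδB p hp).1) (fun p hp => (hδB p hp).2)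
  -- The glued function is known to be smooth only on a ball; `R` is globally smooth and agrees with
  -- it near 0, as the lemmas on graphs require.
  obtain ⟨R, hR, hRg⟩ := exists_contDiff_eventuallyEq Metric.isOpen_ball
    (Metric.mem_ball_self hδ) (glue_contDiffOn Metric.isOpen_ball hr (contDiff_reflect hr) hjet)
  obtain ⟨ε₁, hε₁, hB₁⟩ := Metric.eventually_nhds_iff_ball.1 ((hr0.and hL).and hRg)
  obtain ⟨ε₂, hε₂, hB₂⟩ := Metric.eventually_nhds_iff_ball.1 hH
  set ε := min ε₁ ε₂
  have hε : 0 < ε := lt_min hε₁ hε₂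
  have hB : ∀ q ∈ Metric.ball (0 : ℂ × ℝ) ε, _ :=
    fun q hq => hB₁ q (Metric.ball_subset_ball (min_le_left _ _) hq)
  have hU : ∀ p ∈ Metric.ball (0 : ℂ × ℂ) ε, _ :=
    fun p hp => hB₂ p (Metric.ball_subset_ball (min_le_right _ _) hp)
  have hS : (H ∩ Metric.ball 0 ε) ∪ conjC2 '' (H ∩ Metric.ball 0 ε) =
      {q ∈ Metric.ball (0 : ℂ × ℂ) ε | q.2.im = R (baseProj q)} := by
    ext p
    rw [Set.mem_union, mem_image_conjC2, Set.mem_inter_iff, Set.mem_inter_iff, conjC2_mem_ball,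
      ← or_and_right, and_comm, Set.mem_ofPred_eq]
    refine and_congr_right fun hp => ?_
    have hb := hB _ (baseProj_mem_ball hp)
    rw [hU p hp, hU _ (conjC2_mem_ball.2 hp), hb.2]
    have h1 : baseProj (conjC2 p) = baseConj (baseProj p) := by
      simp [baseProj_apply, baseConj_apply, conjC2]
    have h2 : (baseProj p).1.im = p.1.im := rfl
    have h3 : (conjC2 p).1.im = -p.1.im := by simp [conjC2]
    have h4 : (conjC2 p).2.im = -p.2.im := by simp [conjC2]
    have h5 : reflect r (baseProj p) = -r (baseConj (baseProj p)) := rfl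
    rw [h1, h3, h4]
    rcases lt_trichotomy p.1.im 0 with hy | hy | hy
    · simp only [glue, h2, hy.not_ge, if_false, false_and, false_or, h5]
      constructor
      · rintro ⟨-, h⟩
        linarith
      · intro h
        exact ⟨by linarith, by linarith⟩
    · have := hb.1.1 hy
      simp [glue, h2, hy, this, baseConj_of_im_eq_zero (p := baseProj p) hy]
    · have : ¬ 0 ≤ -p.1.im := by linarith
      simp [glue, h2, hy.le, this]
  have hLR : ∀ q ∈ Metric.ball (0 : ℂ × ℝ) ε, LeviEq R q := by
    have hev : ∀ q ∈ Metric.ball (0 : ℂ × ℝ) ε, R =ᶠ[𝓝 q] glue r (reflect r) := fun q hq =>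
      Filter.eventually_of_mem (Metric.isOpen_ball.mem_nhds hq) fun q' hq' => (hB q' hq').2
    have hpos : ∀ q ∈ Metric.ball (0 : ℂ × ℝ) ε, 0 < q.1.im → LeviEq R q := fun q hq hy =>
      ((hB q hq).1.2 hy).congr ((hev q hq).trans (glue_eventuallyEq_of_pos hy))
    intro q hq
    rcases lt_trichotomy q.1.im 0 with hy | hy | hy
    · exact ((hB _ (baseConj_mem_ball hq)).1.2 (by simpa using hy)).reflect.congr
        ((hev q hq).trans (glue_eventuallyEq_of_neg hy))
    -- Points with y = 0 are limits of points with y > 0, and the equation for the smooth `R` is a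
    -- closed condition.
    · exact closure_minimal (fun q' hq' => hpos q' hq'.1 hq'.2) (isClosed_leviEq hR)
        (mem_closure_inter_im_pos Metric.isOpen_ball hq hy)
    · exact hpos q hq hy
  refine ⟨Metric.ball 0 ε, Metric.isOpen_ball, Metric.mem_ball_self hε, ?_, ?_, ?_⟩
  · ext p
    rw [mem_image_conjC2, conjC2_mem_ball]
  · rw [hS]
    exact isSmoothHypersurface_graph hR Metric.isOpen_ball
  · rw [hS]
    refine isLeviFlat_of_leviEq hR (fun p hp => ?_) fun p hp => hLR _ (baseProj_mem_ball hp.1)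
    filter_upwards [Metric.isOpen_ball.mem_nhds hp.1] with q hq
    exact and_iff_right hq

/-! ### From defining functions to a half graph. -/

/-- A pair of functions `ρ`, `s` that vanish on the real plane and have differentials `Im w`,
`Im z` at `0` cuts out, by `ρ = 0` and `0 ≤ s`, one half of a smooth graph. -/
theorem exists_graph {W : Set (ℂ × ℂ)} (hW : IsOpen W) (h0W : (0 : ℂ × ℂ) ∈ W) {ρ s : ℂ × ℂ → ℝ}
    (hρ : ContDiffOn ℝ ∞ ρ W) (hs : ContDiffOn ℝ ∞ s W)
    (hρ' : fderiv ℝ ρ 0 = Complex.imCLM.comp (ContinuousLinearMap.snd ℝ ℂ ℂ))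
    (hs' : fderiv ℝ s 0 = Complex.imCLM.comp (ContinuousLinearMap.fst ℝ ℂ ℂ))
    (hreal : ∀ᶠ p in 𝓝 (0 : ℂ × ℂ), p ∈ realPlane → ρ p = 0 ∧ s p = 0) :
    ∃ r : ℂ × ℝ → ℝ, ContDiff ℝ ∞ r ∧ (∀ᶠ q in 𝓝 (0 : ℂ × ℝ), q.1.im = 0 → r q = 0) ∧
      ∀ᶠ p in 𝓝 (0 : ℂ × ℂ), (ρ p = 0 ∧ 0 ≤ s p ↔ 0 ≤ p.1.im ∧ p.2.im = r (baseProj p)) := by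
  -- `Ψ` replaces Im w by `ρ` and has the identity as differential at 0; `r` is read off from its
  -- local inverse on the slice `ρ` = 0.
  let Ψ : ℂ × ℂ → ℂ × ℂ := fun p => (p.1, (p.2.re : ℂ) + (ρ p : ℂ) * Complex.I)
  have hΨ : ContDiffOn ℝ ∞ Ψ W := contDiff_fst.contDiffOn.prodMk
    (((Complex.ofRealCLM.contDiff.comp
      (Complex.reCLM.contDiff.comp contDiff_snd)).contDiffOn).add
      ((Complex.ofRealCLM.contDiff.comp_contDiffOn hρ).mul contDiffOn_const))
  have hρ0 : ρ 0 = 0 := (hreal.self_of_nhds ⟨by simp, by simp⟩).1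
  have hΨ0 : Ψ 0 = 0 := by simp [Ψ, hρ0]
  have hρd : HasStrictFDerivAt ρ (Complex.imCLM.comp (ContinuousLinearMap.snd ℝ ℂ ℂ)) 0 := by
    rw [← hρ']
    exact (hρ.contDiffAt (hW.mem_nhds h0W)).hasStrictFDerivAt (by simp)
  have hsd : HasStrictFDerivAt s (Complex.imCLM.comp (ContinuousLinearMap.fst ℝ ℂ ℂ)) 0 := by
    rw [← hs']
    exact (hs.contDiffAt (hW.mem_nhds h0W)).hasStrictFDerivAt (by simp)
  have hΨd : HasFDerivAt Ψ ((ContinuousLinearEquiv.refl ℝ (ℂ × ℂ) : _ →L[ℝ] _)) 0 := by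
    have h1 : HasFDerivAt (fun p : ℂ × ℂ => (p.2.re : ℂ)) _ 0 :=
      (Complex.ofRealCLM.comp
        (Complex.reCLM.comp (ContinuousLinearMap.snd ℝ ℂ ℂ))).hasFDerivAt
    have h2 : HasFDerivAt (fun p : ℂ × ℂ => (ρ p : ℂ)) _ 0 :=
      Complex.ofRealCLM.hasFDerivAt.comp (0 : ℂ × ℂ) hρd.hasFDerivAt
    have h3 : HasFDerivAt Ψ _ 0 := hasFDerivAt_fst.prodMk (h1.add (h2.mul_const' Complex.I))
    refine h3.congr_fderiv ?_
    refine ContinuousLinearMap.ext fun v => Prod.ext ?_ ?_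
    · simp
    · simpa [mul_comm] using Complex.re_add_im v.2
  have hΨc := hΨ.contDiffAt (hW.mem_nhds h0W)
  let e := hΨc.toOpenPartialHomeomorph Ψ hΨd (by simp)
  have he : ∀ p, e p = Ψ p := fun p => rfl
  have h0s : (0 : ℂ × ℂ) ∈ e.source := hΨc.mem_toOpenPartialHomeomorph_source hΨd (by simp)
  have h0t : (0 : ℂ × ℂ) ∈ e.target := by
    have := e.map_source h0s
    rwa [he, hΨ0] at this
  have hsymm0 : e.symm 0 = 0 := by
    have := e.left_inv h0s
    rwa [he, hΨ0] at this
  -- points where the inverse is smooth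
  have hinv : ∀ᶠ p in 𝓝 (0 : ℂ × ℂ), p ∈ W ∧
      fderiv ℝ Ψ p ∈ Set.range ((↑) : ((ℂ × ℂ) ≃L[ℝ] (ℂ × ℂ)) → _) := by
    refine (hW.eventually_mem h0W).and ?_
    have hc : ContinuousAt (fderiv ℝ Ψ) 0 :=
      ((hΨ.continuousOn_fderiv_of_isOpen hW (by simp)).continuousAt (hW.mem_nhds h0W))
    refine hc.eventually_mem ?_
    rw [hΨd.fderiv]
    exact ContinuousLinearEquiv.nhds _
  -- Smoothness of the inverse is needed on a neighbourhood and not only at 0; it holds because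
  -- invertibility of the differential is an open condition.
  have hsm : ∀ᶠ q in 𝓝 (0 : ℂ × ℂ), q ∈ e.target ∧ ContDiffAt ℝ ∞ e.symm q := by
    have hc := (e.symm.continuousAt h0t)
    rw [ContinuousAt, hsymm0] at hc
    filter_upwards [hc.eventually hinv, e.open_target.mem_nhds h0t] with q ⟨hqW, f', hf'⟩ hqt
    refine ⟨hqt, e.contDiffAt_symm (f₀' := f') hqt ?_ (hΨ.contDiffAt (hW.mem_nhds hqW))⟩
    rw [hf']
    exact ((hΨ.contDiffAt (hW.mem_nhds hqW)).differentiableAt (by simp)).hasFDerivAt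
  obtain ⟨N, hN, hNo, h0N⟩ := eventually_nhds_iff.1 hsm
  let j : ℂ × ℝ → ℂ × ℂ := fun q => (q.1, (q.2 : ℂ))
  have hj : ContDiff ℝ ∞ j := contDiff_fst.prodMk (Complex.ofRealCLM.contDiff.comp contDiff_snd)
  have hj0 : j 0 = 0 := by simp [j]
  have hr₁ : ContDiffOn ℝ ∞ (fun q => (e.symm (j q)).2.im) (j ⁻¹' N) := fun q hq =>
    (Complex.imCLM.contDiff.contDiffAt.comp q
      (((hN _ hq).2.comp q hj.contDiffAt).snd)).contDiffWithinAt
  obtain ⟨r, hr, hrr⟩ := exists_contDiff_eventuallyEq (hNo.preimage hj.continuous)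
    (show (0 : ℂ × ℝ) ∈ j ⁻¹' N by simpa [hj0] using h0N) hr₁
  have hbase : Filter.Tendsto baseProj (𝓝 (0 : ℂ × ℂ)) (𝓝 (0 : ℂ × ℝ)) := by
    simpa using baseProj.continuous.tendsto 0
  have hjt : Filter.Tendsto j (𝓝 (0 : ℂ × ℝ)) (𝓝 (0 : ℂ × ℂ)) := by
    simpa [hj0] using hj.continuous.tendsto 0
  have hgraph : ∀ᶠ p in 𝓝 (0 : ℂ × ℂ), (ρ p = 0 ↔ p.2.im = r (baseProj p)) := by
    filter_upwards [hbase.eventually hrr, e.open_source.mem_nhds h0s,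
      (hjt.comp hbase).eventually (e.open_target.mem_nhds h0t)] with p hp hps hpt
    rw [hp]
    constructor
    · intro h
      have : Ψ p = j (baseProj p) := by simp [Ψ, j, h, baseProj_apply]
      rw [← this, ← he, e.left_inv hps]
    · intro h
      have h1 : Ψ (e.symm (j (baseProj p))) = j (baseProj p) := e.right_inv hpt
      have h2 : (e.symm (j (baseProj p))).1 = p.1 := by
        simpa [Ψ, j, baseProj_apply] using congrArg Prod.fst h1
      have h3 := congrArg Prod.snd h1
      have h4 : (e.symm (j (baseProj p))).2.re = p.2.re := by
        simpa [Ψ, j, baseProj_apply] using congrArg Complex.re h3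
      have h5 : e.symm (j (baseProj p)) = p := Prod.ext h2 (Complex.ext h4 h.symm)
      rw [h5] at h3
      simpa [Ψ, j, baseProj_apply] using congrArg Complex.im h3
  refine ⟨r, hr, ?_, ?_⟩
  · filter_upwards [hjt.eventually hreal, hjt.eventually hgraph] with q h1 h2 hy
    have hb : baseProj (j q) = q := by simp [j, baseProj_apply]
    have := h2.1 (h1 ⟨hy, by simp [j]⟩).1
    rw [hb] at this
    simpa [j] using this.symm
  -- Strict differentiability is applied between `p` and the real point `c p`, where `ρ` and `s`
  -- vanish: `ρ p` - Im w and `s p` - Im z are at most half of max(|Im z|, |Im w|). If `ρ p` = 0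
  -- this forces |Im w| ≤ |Im z|, so `s p` lies within |Im z|/2 of Im z and is nonnegative exactly
  -- when Im z is.
  · let c : ℂ × ℂ → ℂ × ℂ := fun p => ((p.1.re : ℂ), (p.2.re : ℂ))
    have hc0 : c 0 = 0 := by simp [c]
    have hc : Filter.Tendsto (fun p => (p, c p)) (𝓝 (0 : ℂ × ℂ))
        (𝓝 ((0, 0) : (ℂ × ℂ) × (ℂ × ℂ))) := by
      have : Continuous fun p => (p, c p) := by fun_prop
      simpa only [hc0] using this.tendsto 0
    have hc' : Filter.Tendsto c (𝓝 (0 : ℂ × ℂ)) (𝓝 0) := by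
      have : Continuous c := by fun_prop
      simpa only [hc0] using this.tendsto 0
    have e1 := hc.eventually (hρd.isLittleO.def (c := 1 / 2) (by norm_num))
    have e2 := hc.eventually (hsd.isLittleO.def (c := 1 / 2) (by norm_num))
    filter_upwards [hgraph, e1, e2, hc'.eventually hreal] with p hg h1 h2 h3
    rw [hg, and_comm]
    refine and_congr_left fun h => ?_
    obtain ⟨h3, h4⟩ := h3 ⟨by simp [c], by simp [c]⟩
    have hsub : ‖p - c p‖ = max |p.1.im| |p.2.im| := by
      have k : ∀ z : ℂ, ‖z - (z.re : ℂ)‖ = |z.im| := fun z => by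
        have : z - (z.re : ℂ) = z.im * Complex.I := by
          apply Complex.ext <;> simp
        rw [this]
        simp
      rw [Prod.norm_def]
      exact congrArg₂ max (k _) (k _)
    rw [hsub] at h1 h2
    simp [hg.2 h, h3, h4, c] at h1 h2
    have hv : |p.2.im| ≤ |p.1.im| := by
      rcases le_total |p.1.im| |p.2.im| with h | h
      · rw [max_eq_right h] at h1
        have := abs_nonneg p.2.im
        have := abs_nonneg p.1.im
        linarith
      · exact h
    rw [max_eq_left hv] at h2
    constructor
    · intro hs0
      by_contra! hy
      rw [abs_of_neg hy] at h2
      linarith [(abs_le.1 h2).2]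
    · intro hy
      rw [abs_of_nonneg hy] at h2
      linarith [(abs_le.1 h2).1]

end NormalForm

/-! ### Invariance under complex linear changes of coordinates. -/

section Transport

variable {S : Set (ℂ × ℂ)} (Φ : (ℂ × ℂ) ≃L[ℂ] (ℂ × ℂ))

theorem contDiff_complex_equiv : ContDiff ℝ ∞ Φ :=
  (Φ.restrictScalars ℝ).contDiff

theorem image_mem_tangentVectors {p v : ℂ × ℂ} (hv : v ∈ tangentVectors S p) :
    Φ v ∈ tangentVectors (Φ '' S) (Φ p) := by
  obtain ⟨γ, hγ, rfl, hS, rfl⟩ := hv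
  refine ⟨Φ ∘ γ, (contDiff_complex_equiv Φ).contDiffAt.comp 0 hγ, rfl,
    hS.mono fun t ht => ⟨_, ht, rfl⟩, ?_⟩
  exact ((Φ.restrictScalars ℝ).hasFDerivAt.comp_hasDerivAt (0 : ℝ)
    (hγ.differentiableAt (by simp)).hasDerivAt).deriv

theorem image_mem_complexTangentVectors {p v : ℂ × ℂ} (hv : v ∈ complexTangentVectors S p) :
    Φ v ∈ complexTangentVectors (Φ '' S) (Φ p) := by
  obtain ⟨⟨w, hw, rfl⟩, hv⟩ := hv
  exact ⟨⟨Φ w, image_mem_tangentVectors Φ hw, by simp⟩, image_mem_tangentVectors Φ hv⟩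

theorem IsLeviFlat.image (hS : IsLeviFlat S) : IsLeviFlat (Φ '' S) := by
  have hback : ∀ {p v : ℂ × ℂ}, v ∈ complexTangentVectors (Φ '' S) (Φ p) →
      Φ.symm v ∈ complexTangentVectors S p := by
    intro p v hv
    simpa [Set.image_image] using image_mem_complexTangentVectors Φ.symm hv
  rintro V X Y hV hX hY hXS hYS _ ⟨⟨p, hp, rfl⟩, hpV⟩
  have hVo : IsOpen (Φ ⁻¹' V) := hV.preimage Φ.continuous
  have hc : ∀ {Z : ℂ × ℂ → ℂ × ℂ}, ContDiffOn ℝ ∞ Z V →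
      ContDiffOn ℝ ∞ (fun q => Φ.symm (Z (Φ q))) (Φ ⁻¹' V) := fun hZ =>
    (contDiff_complex_equiv Φ.symm).comp_contDiffOn
      (hZ.comp (contDiff_complex_equiv Φ).contDiffOn fun _ h => h)
  have key := hS (Φ ⁻¹' V) (fun q => Φ.symm (X (Φ q))) (fun q => Φ.symm (Y (Φ q))) hVo
    (hc hX) (hc hY)
    (fun q hq => hback (hXS _ ⟨⟨q, hq.1, rfl⟩, hq.2⟩))
    (fun q hq => hback (hYS _ ⟨⟨q, hq.1, rfl⟩, hq.2⟩)) p ⟨hp, hpV⟩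
  have hd : ∀ {Z : ℂ × ℂ → ℂ × ℂ}, ContDiffOn ℝ ∞ Z V → ∀ v,
      fderiv ℝ (fun q => Φ.symm (Z (Φ q))) p v = Φ.symm (fderiv ℝ Z (Φ p) (Φ v)) := by
    intro Z hZ v
    have dZ := ((hZ.contDiffAt (hV.mem_nhds hpV)).differentiableAt (by simp)).hasFDerivAt
    have h1 : HasFDerivAt (fun q => Φ.symm (Z (Φ q))) _ p :=
      (Φ.symm.restrictScalars ℝ).hasFDerivAt.comp p
        (dZ.comp p (Φ.restrictScalars ℝ).hasFDerivAt)
    rw [h1.fderiv]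
    rfl
  have := image_mem_complexTangentVectors Φ key
  rw [VectorField.lieBracket, hd hX, hd hY] at this
  simpa [VectorField.lieBracket] using this

theorem IsSmoothHypersurface.image (hS : IsSmoothHypersurface S) :
    IsSmoothHypersurface (Φ '' S) := by
  rintro _ ⟨p, hp, rfl⟩
  obtain ⟨e, ⟨he1, he2⟩, hpe, him⟩ := hS p hp
  refine ⟨Φ.symm.toHomeomorph.transOpenPartialHomeomorph e, ⟨?_, ?_⟩, by simpa using hpe, ?_⟩
  · exact he1.comp (contDiff_complex_equiv Φ.symm).contDiffOn fun _ h => h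
  · exact (contDiff_complex_equiv Φ).comp_contDiffOn he2
  · have ht : (Φ.symm.toHomeomorph.transOpenPartialHomeomorph e).target = e.target := rfl
    rw [ht, ← him]
    ext x
    constructor
    · rintro ⟨_, ⟨⟨q, hq, rfl⟩, hqs⟩, rfl⟩
      exact ⟨q, ⟨hq, by simpa using hqs⟩, by simp⟩
    · rintro ⟨q, ⟨hq, hqs⟩, rfl⟩
      exact ⟨Φ q, ⟨⟨q, hq, rfl⟩, by simpa using hqs⟩, by simp⟩

end Transport

/-- A real invertible matrix acts on `ℂ²`. -/
theorem exists_real_linear_equiv {a b c d : ℝ} (h : a * d - b * c ≠ 0) :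
    ∃ Φ : (ℂ × ℂ) ≃L[ℂ] (ℂ × ℂ), ∀ p, Φ p = (a * p.1 + b * p.2, c * p.1 + d * p.2) := by
  let M : ℝ → ℝ → ℝ → ℝ → (ℂ × ℂ) →L[ℂ] (ℂ × ℂ) := fun a b c d =>
    ((a : ℂ) • ContinuousLinearMap.fst ℂ ℂ ℂ + (b : ℂ) • ContinuousLinearMap.snd ℂ ℂ ℂ).prod
      ((c : ℂ) • ContinuousLinearMap.fst ℂ ℂ ℂ + (d : ℂ) • ContinuousLinearMap.snd ℂ ℂ ℂ)
  have hM : ∀ a b c d p, M a b c d p = (a * p.1 + b * p.2, c * p.1 + d * p.2) := by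
    intro a b c d p
    simp [M]
  obtain ⟨D, hD⟩ : ∃ D : ℝ, D = a * d - b * c := ⟨_, rfl⟩
  have hDc : (D : ℂ) = a * d - b * c := by exact_mod_cast hD
  have hD0 : (D : ℂ) ≠ 0 := by
    rw [← hD] at h
    exact_mod_cast h
  refine ⟨ContinuousLinearEquiv.equivOfInverse (M a b c d) (M (d / D) (-b / D) (-c / D) (a / D))
    (fun p => ?_) fun p => ?_, fun p => hM a b c d p⟩
  all_goals
    rw [hM, hM]
    refine Prod.ext ?_ ?_ <;> push_cast <;> field_simp
    · linear_combination (-p.1) * hDc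
    · linear_combination (-p.2) * hDc

/-! ### The boundary is open in the real plane. -/

section BoundaryChart

variable {bH : Set (ℂ × ℂ)} {e : OpenPartialHomeomorph (ℂ × ℂ) (Fin 4 → ℝ)}

/-- The inclusion of the real plane in `ℂ²`. -/
noncomputable def realIncl : (ℝ × ℝ) →L[ℝ] (ℂ × ℂ) := Complex.ofRealCLM.prodMap Complex.ofRealCLM

/-- The real part, from `ℂ²` to the real plane. -/
noncomputable def realPartC2 : (ℂ × ℂ) →L[ℝ] (ℝ × ℝ) := Complex.reCLM.prodMap Complex.reCLM

theorem realIncl_realPart {p : ℂ × ℂ} (hp : p ∈ realPlane) : realIncl (realPartC2 p) = p :=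
  Prod.ext (Complex.ext (by simp [realIncl, realPartC2]) (by simp [realIncl, hp.1]))
    (Complex.ext (by simp [realIncl, realPartC2]) (by simp [realIncl, hp.2]))

theorem IsSmoothDiffeo.fderiv_inverse (he : IsSmoothDiffeo e) {p : ℂ × ℂ} (hp : p ∈ e.source)
    (x : Fin 4 → ℝ) : fderiv ℝ e p (fderiv ℝ e.symm (e p) x) = x := by
  have ht := e.map_source hp
  have d1 := ((he.1.contDiffAt (e.open_source.mem_nhds hp)).differentiableAt (by simp)).hasFDerivAt
  have d2 := ((he.2.contDiffAt (e.open_target.mem_nhds ht)).differentiableAt (by simp)).hasFDerivAt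
  have hp' : e.symm (e p) = p := e.left_inv hp
  rw [← hp'] at d1
  have h1 := d1.comp (e p) d2
  have h2 : HasFDerivAt (e ∘ e.symm) (ContinuousLinearMap.id ℝ (Fin 4 → ℝ)) (e p) :=
    (hasFDerivAt_id (e p)).congr_of_eventuallyEq
      (Filter.eventually_of_mem (e.open_target.mem_nhds ht) fun y hy => e.right_inv hy)
  have := congrArg (fun L => L x) (h1.unique h2)
  rw [hp'] at this
  exact this

/-- A smooth surface contained in the real plane is open in the real plane. -/
theorem eventually_mem_of_subset_realPlane (he : IsSmoothDiffeo e) (h0s : (0 : ℂ × ℂ) ∈ e.source)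
    (h0 : (0 : ℂ × ℂ) ∈ bH) (hbH : bH ⊆ realPlane)
    (him : e '' (bH ∩ e.source) = {x | x 2 = 0 ∧ x 3 = 0}) :
    ∀ᶠ p in 𝓝 (0 : ℂ × ℂ), p ∈ realPlane → p ∈ bH := by
  have he0 : e 0 ∈ {x : Fin 4 → ℝ | x 2 = 0 ∧ x 3 = 0} := him ▸ ⟨0, ⟨h0, h0s⟩, rfl⟩
  let ι : (ℝ × ℝ) →L[ℝ] (Fin 4 → ℝ) := ContinuousLinearMap.pi
    ![ContinuousLinearMap.fst ℝ ℝ ℝ, ContinuousLinearMap.snd ℝ ℝ ℝ, 0, 0]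
  have hι : ∀ t, ι t = ![t.1, t.2, 0, 0] := fun t => by
    funext i
    fin_cases i <;> rfl
  let c : ℝ × ℝ → ℂ × ℂ := fun t => e.symm (e 0 + ι t)
  have hc : ∀ t, c t ∈ bH := by
    intro t
    have : e 0 + ι t ∈ {x : Fin 4 → ℝ | x 2 = 0 ∧ x 3 = 0} :=
      ⟨by simp [hι, he0.1], by simp [hι, he0.2]⟩
    rw [← him] at this
    obtain ⟨q, hq, hqe⟩ := this
    simp only [c]
    rw [← hqe, e.left_inv hq.2]
    exact hq.1
  have hc0 : c 0 = 0 := by simp [c, h0s]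
  have ht := e.map_source h0s
  have d2 : HasStrictFDerivAt e.symm (fderiv ℝ e.symm (e 0)) (e 0 + ι 0) := by
    have := (he.2.contDiffAt (e.open_target.mem_nhds ht)).hasStrictFDerivAt (by simp)
    simpa using this
  have dc : HasStrictFDerivAt c ((fderiv ℝ e.symm (e 0)).comp ι) 0 :=
    d2.comp (0 : ℝ × ℝ) (ι.hasStrictFDerivAt.const_add (e 0))
  have dh : HasStrictFDerivAt (realPartC2 ∘ c)
      (realPartC2.comp ((fderiv ℝ e.symm (e 0)).comp ι)) 0 :=
    realPartC2.hasStrictFDerivAt.comp (0 : ℝ × ℝ) dc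
  -- The parametrization `c` takes values in the real plane, so passing to real parts loses nothing
  -- of its differential; the planar map therefore inherits injectivity, and with equal dimensions
  -- surjectivity.
  have hreal : (realIncl.comp (realPartC2.comp ((fderiv ℝ e.symm (e 0)).comp ι))) =
      (fderiv ℝ e.symm (e 0)).comp ι := by
    have h1 : HasFDerivAt (realIncl ∘ realPartC2 ∘ c) _ 0 :=
      (realIncl.hasStrictFDerivAt.comp (0 : ℝ × ℝ) dh).hasFDerivAt
    have h2 : realIncl ∘ realPartC2 ∘ c = c := funext fun t => realIncl_realPart (hbH (hc t))
    rw [h2] at h1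
    exact h1.unique dc.hasFDerivAt
  have hinj : Function.Injective (realPartC2.comp ((fderiv ℝ e.symm (e 0)).comp ι)) := by
    intro s t hst
    have h1 := congrArg realIncl hst
    rw [← ContinuousLinearMap.comp_apply, ← ContinuousLinearMap.comp_apply, hreal] at h1
    have h2 := congrArg (fderiv ℝ e 0) h1
    simp only [ContinuousLinearMap.comp_apply, he.fderiv_inverse h0s, hι] at h2
    exact Prod.ext (congrFun h2 0) (congrFun h2 1)
  have hsurj := LinearMap.range_eq_top.2 (LinearMap.injective_iff_surjective.1 hinj)
  have hmap := dh.map_nhds_eq_of_surj hsurj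
  have hrange : ∀ᶠ t in 𝓝 (0 : ℝ × ℝ), ∃ t', realPartC2 (c t') = t := by
    have : (realPartC2 ∘ c) 0 = 0 := by simp [hc0]
    rw [this] at hmap
    rw [← hmap]
    exact Filter.eventually_map.2 (Filter.Eventually.of_forall fun t => ⟨t, rfl⟩)
  have hcont : Filter.Tendsto realPartC2 (𝓝 (0 : ℂ × ℂ)) (𝓝 (0 : ℝ × ℝ)) := by
    simpa using realPartC2.continuous.tendsto 0
  filter_upwards [hcont.eventually hrange] with p ⟨t, ht⟩ hp
  have := congrArg realIncl ht
  rw [realIncl_realPart hp, realIncl_realPart (hbH (hc t))] at this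
  exact this ▸ hc t

end BoundaryChart

/-! ### Normalization of the boundary chart and conclusion. -/

theorem theorem3p1 (H bH : Set (ℂ × ℂ))
    (hH : IsSmoothHypersurfaceWithBoundary H bH)
    (hflat : IsLeviFlat (H \ bH))
    (h0 : (0 : ℂ × ℂ) ∈ bH)
    (hbH : bH ⊆ realPlane) :
    ∃ U : Set (ℂ × ℂ), IsOpen U ∧ (0 : ℂ × ℂ) ∈ U ∧ U = conjC2 '' U ∧
      IsSmoothHypersurface ((H ∩ U) ∪ conjC2 '' (H ∩ U)) ∧
      IsLeviFlat ((H ∩ U) ∪ conjC2 '' (H ∩ U)) := by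
  obtain ⟨e, he, h0s, -, himH, himb⟩ := hH.boundary_chart 0 h0
  have hreal := eventually_mem_of_subset_realPlane he h0s h0 hbH himb
  have hmemH : ∀ p ∈ e.source, (p ∈ H ↔ e p 3 = 0 ∧ 0 ≤ e p 2) := by
    intro p hp
    constructor
    · intro h
      have : e p ∈ {x : Fin 4 → ℝ | 0 ≤ x 2 ∧ x 3 = 0} := himH ▸ ⟨p, ⟨h, hp⟩, rfl⟩
      exact this.symm
    · intro h
      have : e p ∈ e '' (H ∩ e.source) := himH ▸ h.symm
      obtain ⟨q, hq, hqp⟩ := this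
      exact e.injOn hq.2 hp hqp ▸ hq.1
  have hvan : ∀ᶠ p in 𝓝 (0 : ℂ × ℂ), p ∈ realPlane → e p 3 = 0 ∧ e p 2 = 0 := by
    filter_upwards [hreal, e.open_source.mem_nhds h0s] with p h1 h2 h3
    have : e p ∈ {x : Fin 4 → ℝ | x 2 = 0 ∧ x 3 = 0} := himb ▸ ⟨p, ⟨h1 h3, h2⟩, rfl⟩
    exact this.symm
  have dcoord : ∀ i : Fin 4, HasFDerivAt (fun p => e p i)
      ((ContinuousLinearMap.proj (R := ℝ) (φ := fun _ : Fin 4 => ℝ) i).comp (fderiv ℝ e 0)) 0 :=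
    fun i => (ContinuousLinearMap.proj (R := ℝ) (φ := fun _ : Fin 4 => ℝ) i).hasFDerivAt.comp
      (0 : ℂ × ℂ)
      ((he.1.contDiffAt (e.open_source.mem_nhds h0s)).differentiableAt (by simp)).hasFDerivAt
  -- The chart coordinates with indices 2 and 3 vanish on ℝ² near 0, so their differentials kill ℝ²
  -- and, by `hform`, are real combinations of Im z and Im w.
  have hkill : ∀ t : ℝ × ℝ, fderiv ℝ e 0 (realIncl t) 3 = 0 ∧ fderiv ℝ e 0 (realIncl t) 2 = 0 := by
    have hev : ∀ᶠ t in 𝓝 (0 : ℝ × ℝ), e (realIncl t) 3 = 0 ∧ e (realIncl t) 2 = 0 := by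
      have hc : Filter.Tendsto realIncl (𝓝 0) (𝓝 0) := by
        simpa using realIncl.continuous.tendsto 0
      filter_upwards [hc.eventually hvan] with t ht
      exact ht ⟨by simp [realIncl], by simp [realIncl]⟩
    have key : ∀ i : Fin 4, (∀ᶠ t in 𝓝 (0 : ℝ × ℝ), e (realIncl t) i = 0) →
        ∀ t, fderiv ℝ e 0 (realIncl t) i = 0 := by
      intro i hi t
      have h1 := dcoord i
      rw [← map_zero realIncl] at h1
      have h2 := h1.comp (0 : ℝ × ℝ) realIncl.hasFDerivAt
      have h3 := h2.unique ((hasFDerivAt_const (0 : ℝ) (0 : ℝ × ℝ)).congr_of_eventuallyEq hi)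
      simpa using congrArg (fun L => L t) h3
    exact fun t => ⟨key 3 (hev.mono fun _ h => h.1) t, key 2 (hev.mono fun _ h => h.2) t⟩
  have hform : ∀ i : Fin 4, (∀ t, fderiv ℝ e 0 (realIncl t) i = 0) → ∀ p : ℂ × ℂ,
      fderiv ℝ e 0 p i = fderiv ℝ e 0 (Complex.I, 0) i * p.1.im
        + fderiv ℝ e 0 (0, Complex.I) i * p.2.im := by
    intro i hi p
    have hp : p = realIncl (realPartC2 p) + (p.1.im • ((Complex.I, 0) : ℂ × ℂ)
        + p.2.im • ((0, Complex.I) : ℂ × ℂ)) := by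
      refine Prod.ext (Complex.ext ?_ ?_) (Complex.ext ?_ ?_) <;> simp [realIncl, realPartC2]
    conv_lhs => rw [hp]
    rw [map_add, map_add, map_smul, map_smul]
    simp only [Pi.add_apply, Pi.smul_apply, hi, smul_eq_mul]
    ring
  have f3 := hform 3 fun t => (hkill t).1
  have f2 := hform 2 fun t => (hkill t).2
  set c₁ := fderiv ℝ e 0 (Complex.I, 0) 3
  set c₂ := fderiv ℝ e 0 (0, Complex.I) 3
  set d₁ := fderiv ℝ e 0 (Complex.I, 0) 2
  set d₂ := fderiv ℝ e 0 (0, Complex.I) 2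
  -- The differential of the chart is surjective, so the two forms are independent: preimages P, Q
  -- of the last two basis vectors would otherwise give 1 = 0.
  have hdet : d₁ * c₂ - d₂ * c₁ ≠ 0 := by
    intro hD
    have hP := he.fderiv_inverse h0s ![0, 0, 1, 0]
    have hQ := he.fderiv_inverse h0s ![0, 0, 0, 1]
    generalize fderiv ℝ e.symm (e 0) ![0, 0, 1, 0] = P at hP
    generalize fderiv ℝ e.symm (e 0) ![0, 0, 0, 1] = Q at hQ
    have p2 := f2 P
    have p3 := f3 P
    have q2 := f2 Q
    have q3 := f3 Q
    simp only [hP, hQ, Matrix.cons_val] at p2 p3 q2 q3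
    have : (d₁ * P.1.im + d₂ * P.2.im) * (c₁ * Q.1.im + c₂ * Q.2.im)
        - (c₁ * P.1.im + c₂ * P.2.im) * (d₁ * Q.1.im + d₂ * Q.2.im)
        = (d₁ * c₂ - d₂ * c₁) * (P.1.im * Q.2.im - P.2.im * Q.1.im) := by ring
    rw [← p2, ← p3, ← q2, ← q3, hD] at this
    norm_num at this
  -- The rows of the matrix are the coefficients of the two forms, so that after `Φ` the
  -- differentials become Im z and Im w. Having real entries, `Φ` commutes with conjugation.
  obtain ⟨Φ, hΦ⟩ := exists_real_linear_equiv hdet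
  have hΦconj : ∀ p, Φ (conjC2 p) = conjC2 (Φ p) := fun p => by
    simp [hΦ, conjC2]
  have hΦreal : ∀ p, Φ p ∈ realPlane ↔ p ∈ realPlane := by
    have hiff : ∀ p, p ∈ realPlane ↔ conjC2 p = p := fun p => by
      simp [realPlane, conjC2, Prod.ext_iff, Complex.conj_eq_iff_im]
    intro p
    rw [hiff, hiff, ← hΦconj, Φ.injective.eq_iff]
  have hΨt : Filter.Tendsto Φ.symm (𝓝 0) (𝓝 0) := by simpa using Φ.symm.continuous.tendsto 0
  have hcd : ∀ i : Fin 4, ContDiffOn ℝ ∞ (fun p => e (Φ.symm p) i) (Φ.symm ⁻¹' e.source) :=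
    fun i => (contDiff_apply ℝ ℝ i).comp_contDiffOn
      (he.1.comp (contDiff_complex_equiv Φ.symm).contDiffOn fun _ h => h)
  have hder : ∀ i : Fin 4, ∀ v, fderiv ℝ (fun p => e (Φ.symm p) i) 0 v =
      fderiv ℝ e 0 (Φ.symm v) i := by
    intro i v
    have h1 := dcoord i
    rw [← map_zero Φ.symm] at h1
    have h2 : HasFDerivAt (fun p => e (Φ.symm p) i) _ 0 :=
      h1.comp (0 : ℂ × ℂ) (Φ.symm.restrictScalars ℝ).hasFDerivAt
    rw [h2.fderiv, map_zero]
    rfl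
  have hΦim : ∀ v, fderiv ℝ e 0 (Φ.symm v) 3 = v.2.im ∧ fderiv ℝ e 0 (Φ.symm v) 2 = v.1.im := by
    intro v
    obtain ⟨q, rfl⟩ := Φ.surjective v
    rw [Φ.symm_apply_apply, f3, f2, hΦ]
    simp
  obtain ⟨r, hr, hr0, hgraph⟩ := exists_graph (e.open_source.preimage Φ.symm.continuous)
    (by simpa using h0s) (hcd 3) (hcd 2)
    (ContinuousLinearMap.ext fun v => by rw [hder, (hΦim v).1]; rfl)
    (ContinuousLinearMap.ext fun v => by rw [hder, (hΦim v).2]; rfl)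
    (by
      filter_upwards [hΨt.eventually hvan] with p hp hpr
      exact hp ((hΦreal _).1 (by simpa using hpr)))
  have hmem : ∀ {A : Set (ℂ × ℂ)} {p}, p ∈ Φ '' A ↔ Φ.symm p ∈ A := fun {A p} =>
    ⟨by rintro ⟨q, hq, rfl⟩; simpa using hq, fun h => ⟨_, h, by simp⟩⟩
  obtain ⟨U, hU, h0U, hUconj, hS, hL⟩ := exists_reflection_of_graph (H := Φ '' H) (bH := Φ '' bH)
    hr hr0
    (by
      filter_upwards [hgraph, hΨt.eventually (e.open_source.mem_nhds h0s)] with p hp hps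
      rw [hmem, hmemH _ hps, hp])
    (by
      rintro _ ⟨p, hp, rfl⟩
      exact (hΦreal p).2 (hbH hp))
    (by
      rw [← Set.image_sdiff Φ.injective]
      exact hflat.image Φ)
  have hsconj : ∀ p, Φ.symm (conjC2 p) = conjC2 (Φ.symm p) := fun p => by
    rw [Φ.symm_apply_eq, hΦconj, Φ.apply_symm_apply]
  have himg : Φ.symm '' ((Φ '' H ∩ U) ∪ conjC2 '' (Φ '' H ∩ U)) =
      (H ∩ Φ ⁻¹' U) ∪ conjC2 '' (H ∩ Φ ⁻¹' U) := by
    have h1 : Φ.symm '' (Φ '' H ∩ U) = H ∩ Φ ⁻¹' U := by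
      ext p
      constructor
      · rintro ⟨_, ⟨⟨q, hq, rfl⟩, hqU⟩, rfl⟩
        simpa using ⟨hq, hqU⟩
      · rintro ⟨h, h'⟩
        exact ⟨Φ p, ⟨⟨p, h, rfl⟩, h'⟩, by simp⟩
    rw [Set.image_union, ← h1, Set.image_image, Set.image_image]
    simp only [hsconj]
  refine ⟨Φ ⁻¹' U, hU.preimage Φ.continuous, by simpa using h0U, ?_, ?_, ?_⟩
  · ext p
    rw [mem_image_conjC2, Set.mem_preimage, Set.mem_preimage, hΦconj, ← mem_image_conjC2, ← hUconj]
  · rw [← himg]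
    exact hS.image Φ.symm
  · rw [← himg]
    exact hL.image Φ.symm
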